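/- Let $G$ be a real linear time-invariant (LTI) system $\dot x=Ax+Bw,\ r=Cx+Dw$ with $x\in\mathbb R^n$, $w\in\mathbb R^m$, $r\in\mathbb R^p$, which is asymptotically stable (all eigenvalues of $A$ have negative real part), with transfer function $G(s)=C(sI-A)^{-1}B+D$ and $\|G\|_{H_\infty}=\sup_{\mathrm{Re}\,s\ge 0}\|G(s)\|_2$. Let $\Delta$ be an $H_\infty$-minimal destabilizing feedback attack on $G$, that is, a real LTI system $\dot{\tilde x}=\tilde A\tilde x+\tilde B r,\ w=\tilde C\tilde x+\tilde D r$ with $\tilde x\in\mathbb R^k$, all eigenvalues of $\tilde A$ having negative real part, and transfer function $\Delta(s)=\tilde C(sI-\tilde A)^{-1}\tilde B+\tilde D$, such that (i) $\det(I-\Delta(j\omega_0)G(j\omega_0))=0$ for some $\omega_0\in\mathbb R$, and (ii) $\|\Delta\|_{H_\infty}=1/\|G\|_{H_\infty}$. Assume that the feedback interconnection of $G$ and $\Delta$ is well posed: $\det(I-\tilde D D)\neq 0$. For $\epsilon>0$ let $\Delta_\epsilon=(1+\epsilon)\Delta$, with realization $(\tilde A,\tilde B,(1+\epsilon)\tilde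 C,(1+\epsilon)\tilde D)$. (a) For all sufficiently small $\epsilon>0$ the feedback interconnection of $G$ and $\Delta_\epsilon$ is well posed, $\det(I-(1+\epsilon)\tilde D D)\ne0$, and internally unstable: the system matrix of the linear closed loop in the state $(x,\tilde x)$ has an eigenvalue with positive real part, and the origin is an unstable (that is, not Lyapunov stable) equilibrium of the closed loop. (b) Let $\dot x=f(x,w),\ r=g(x,w)$ be a nonlinear system (the exposed system) with $f(0,0)=0$ and $g(0,0)=0$, where $f$ and $g$ are $C^1$ in a neighborhood of $(0,0)$, whose linearization at $(0,0)$ is $G$. Assume that either $\tilde D=0$, or $g$ is everywhere differentiable in $w$ and $\sup_{x,w}\|\tilde D\,\tfrac{\partial g}{\partial w}(x,w)\|_2<1$. Then for all sufficiently small $\epsilon>0$ the feedback interconnection of the exposed system with $\Delta_\epsilon$ is well posed, in the sense that $I-(1+\epsilon)\tilde D\,\tfrac{\partial g}{\partial w}(x,w)$ is invertible for all $(x,w)$ (read as $I$ if $\tilde D=0$), the equation $w=(1+\epsilon)(\tilde C\tilde x+\tilde D\,g(x,w))$ has exactly one solution $w$ for every $(x,\tilde x)$, and the resulting closed-loop vector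 field $(x,\tilde x)\mapsto(f(x,w),\ \tilde A\tilde x+\tilde B g(x,w))$ is $C^1$ near the origin; and the origin is an unstable equilibrium of this closed loop. -/

import Mathlib

open Set Filter Topology
open scoped Matrix Matrix.Norms.L2Operator ENNReal

noncomputable section

namespace FeedbackAttack

/-! Stability of equilibria of autonomous systems `x' = F x`. -/

/-- `x` solves `x' = F x` on the time interval `[0, T]` (one-sided derivatives at the ends). -/
def IsSolutionOn {E : Type*} [NormedAddCommGroup E] [NormedSpace ℝ E]
    (F : E → E) (x : ℝ → E) (T : ℝ) : Prop :=
  ∀ t ∈ Icc (0 : ℝ) T, HasDerivWithinAt x (F (x t)) (Icc (0 : ℝ) T) t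

/-- Lyapunov stability of `xe`. Solutions on arbitrary finite intervals `[0, T]` are tested, so a
solution that leaves a neighbourhood of `xe` violates stability even if it blows up later.
The notion does not depend on the choice among equivalent norms. -/
def LyapunovStable {E : Type*} [NormedAddCommGroup E] [NormedSpace ℝ E]
    (F : E → E) (xe : E) : Prop :=
  ∀ ε > 0, ∃ δ > 0, ∀ T : ℝ, 0 ≤ T → ∀ x : ℝ → E, IsSolutionOn F x T →
    ‖x 0 - xe‖ < δ → ∀ t ∈ Icc (0 : ℝ) T, ‖x t - xe‖ < ε

/-- `xe` is an equilibrium of `x' = F x` that is not Lyapunov stable. -/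
def IsUnstableEquilibrium {E : Type*} [NormedAddCommGroup E] [NormedSpace ℝ E]
    (F : E → E) (xe : E) : Prop :=
  F xe = 0 ∧ ¬ LyapunovStable F xe

/-! Linear time-invariant systems. -/

/-- A real state-space LTI system `x' = A x + B u`, `y = C x + D u` with
`n` states, `m` inputs and `p` outputs. -/
structure LTI (n m p : ℕ) where
  A : Matrix (Fin n) (Fin n) ℝ
  B : Matrix (Fin n) (Fin m) ℝ
  C : Matrix (Fin p) (Fin n) ℝ
  D : Matrix (Fin p) (Fin m) ℝ

/-- Asymptotic stability of an LTI system: all eigenvalues of `A` have negative real part. -/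
def LTI.IsStable {n m p : ℕ} (G : LTI n m p) : Prop :=
  ∀ μ ∈ spectrum ℂ (G.A.map Complex.ofReal), μ.re < 0

/-- The transfer function `C (s I - A)⁻¹ B + D`, for `s` outside the spectrum of `A`. -/
def LTI.transfer {n m p : ℕ} (G : LTI n m p) (s : ℂ) : Matrix (Fin p) (Fin m) ℂ :=
  G.C.map Complex.ofReal *
      (s • (1 : Matrix (Fin n) (Fin n) ℂ) - G.A.map Complex.ofReal)⁻¹ * G.B.map Complex.ofReal
    + G.D.map Complex.ofReal

/-- The `H∞` norm of a stable LTI system: the supremum over the closed right half plane of the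
spectral norm (largest singular value) of the transfer function. -/
def LTI.hinfNorm {n m p : ℕ} (G : LTI n m p) : ℝ≥0∞ :=
  ⨆ s : {s : ℂ // 0 ≤ s.re}, ‖G.transfer s‖ₑ

/-- The system `c Δ`: the output of `Δ` is multiplied by the real gain `c`. -/
def LTI.scale {n m p : ℕ} (c : ℝ) (G : LTI n m p) : LTI n m p where
  A := G.A
  B := G.B
  C := c • G.C
  D := c • G.D

/-- `Δ` is an `H∞`-minimal destabilizing feedback attack on `G`. -/
structure IsMinimalDestabilizingAttack {n m p k : ℕ} (G : LTI n m p) (Δ : LTI k p m) :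
    Prop where
  stable : Δ.IsStable
  destabilizing : ∃ ω : ℝ,
    (1 - Δ.transfer (ω * Complex.I) * G.transfer (ω * Complex.I)).det = 0
  minimal : Δ.hinfNorm = 1 / G.hinfNorm

/-! The linear feedback loop `x' = A x + B w`, `r = C x + D w`,
`y' = A₁ y + B₁ r`, `w = C₁ y + D₁ r`. -/

/-- Well-posedness of the linear feedback loop. -/
def LTI.LoopWellPosed {n m p k : ℕ} (G : LTI n m p) (Δ : LTI k p m) : Prop :=
  (1 - Δ.D * G.D).det ≠ 0

/-- System matrix of the (well-posed) linear feedback loop in the state `(x, y)`, obtained by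
eliminating `w = (1 - D₁ D)⁻¹ (D₁ C x + C₁ y)` and `r = C x + D w`. -/
def LTI.loopMatrix {n m p k : ℕ} (G : LTI n m p) (Δ : LTI k p m) :
    Matrix (Fin n ⊕ Fin k) (Fin n ⊕ Fin k) ℝ :=
  Matrix.fromBlocks
    (G.A + G.B * (1 - Δ.D * G.D)⁻¹ * Δ.D * G.C)
    (G.B * (1 - Δ.D * G.D)⁻¹ * Δ.C)
    (Δ.B * (G.C + G.D * (1 - Δ.D * G.D)⁻¹ * Δ.D * G.C))
    (Δ.A + Δ.B * G.D * (1 - Δ.D * G.D)⁻¹ * Δ.C)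

/-- Internal instability of the linear feedback loop: its system matrix has an eigenvalue with
positive real part, and the origin is an unstable equilibrium of the loop dynamics. -/
def LTI.LoopInternallyUnstable {n m p k : ℕ} (G : LTI n m p) (Δ : LTI k p m) : Prop :=
  (∃ μ ∈ spectrum ℂ ((G.loopMatrix Δ).map Complex.ofReal), 0 < μ.re) ∧
    IsUnstableEquilibrium (fun z : Fin n ⊕ Fin k → ℝ => G.loopMatrix Δ *ᵥ z) 0

/-! The nonlinear exposed system and its feedback loop with an LTI system. -/

/-- The exposed system `x' = f(x, w)`, `r = g(x, w)`. -/
structure ExposedSystem (n m p : ℕ) where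
  f : (Fin n → ℝ) → (Fin m → ℝ) → (Fin n → ℝ)
  g : (Fin n → ℝ) → (Fin m → ℝ) → (Fin p → ℝ)

/-- The origin is an equilibrium with zero output, and `f`, `g` are continuously differentiable
in a neighbourhood of the origin. -/
structure ExposedSystem.IsRegular {n m p : ℕ} (S : ExposedSystem n m p) : Prop where
  f_zero : S.f 0 0 = 0
  g_zero : S.g 0 0 = 0
  f_smooth : ContDiffAt ℝ 1 (fun z : (Fin n → ℝ) × (Fin m → ℝ) => S.f z.1 z.2) 0
  g_smooth : ContDiffAt ℝ 1 (fun z : (Fin n → ℝ) × (Fin m → ℝ) => S.g z.1 z.2) 0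

/-- The Jacobian matrix of `φ` at `x`. -/
def jacobian {a b : ℕ} (φ : (Fin a → ℝ) → (Fin b → ℝ)) (x : Fin a → ℝ) :
    Matrix (Fin b) (Fin a) ℝ :=
  LinearMap.toMatrix' (fderiv ℝ φ x : (Fin a → ℝ) →ₗ[ℝ] (Fin b → ℝ))

/-- The linearization of the exposed system at `(x, w) = (0, 0)`. -/
def ExposedSystem.linearization {n m p : ℕ} (S : ExposedSystem n m p) : LTI n m p where
  A := jacobian (fun x => S.f x 0) 0
  B := jacobian (fun w => S.f 0 w) 0
  C := jacobian (fun x => S.g x 0) 0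
  D := jacobian (fun w => S.g 0 w) 0

/-- The loop is robustly well-connected: either `Δ` has no direct feedthrough `D₁`, or
`‖D₁ (∂g/∂w)(x, w)‖₂` is bounded by a constant smaller than `1`, uniformly in `(x, w)`. -/
def ExposedSystem.RobustlyWellConnected {n m p k : ℕ}
    (S : ExposedSystem n m p) (Δ : LTI k p m) : Prop :=
  Δ.D = 0 ∨ ∃ q : ℝ, q < 1 ∧ ∀ x w,
    DifferentiableAt ℝ (S.g x) w ∧ ‖Δ.D * jacobian (S.g x) w‖ ≤ q

/-- `w` solves the algebraic loop equation `w = C₁ y + D₁ g(x, w)` at the state `z = (x, y)`. -/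
def ExposedSystem.IsLoopInput {n m p k : ℕ} (S : ExposedSystem n m p) (Δ : LTI k p m)
    (z : (Fin n → ℝ) × (Fin k → ℝ)) (w : Fin m → ℝ) : Prop :=
  w = Δ.C *ᵥ z.2 + Δ.D *ᵥ S.g z.1 w

/-- The solution `w` of the algebraic loop equation at `z` (meaningful when there is exactly one,
which is part of well-posedness). -/
def ExposedSystem.loopInput {n m p k : ℕ} (S : ExposedSystem n m p) (Δ : LTI k p m)
    (z : (Fin n → ℝ) × (Fin k → ℝ)) : Fin m → ℝ :=
  Classical.epsilon (S.IsLoopInput Δ z)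

/-- The vector field of the nonlinear feedback loop: `x' = f(x, w)`, `y' = A₁ y + B₁ g(x, w)`
with `w` determined by the algebraic loop equation. -/
def ExposedSystem.loopField {n m p k : ℕ} (S : ExposedSystem n m p) (Δ : LTI k p m)
    (z : (Fin n → ℝ) × (Fin k → ℝ)) : (Fin n → ℝ) × (Fin k → ℝ) :=
  (S.f z.1 (S.loopInput Δ z), Δ.A *ᵥ z.2 + Δ.B *ᵥ S.g z.1 (S.loopInput Δ z))

/-- Well-posedness of the nonlinear feedback loop: `I - D₁ ∂g/∂w` is invertible everywhere, the
algebraic loop equation has exactly one solution at every state, and the resulting vector field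
is continuously differentiable near the origin. -/
structure ExposedSystem.LoopWellPosed {n m p k : ℕ}
    (S : ExposedSystem n m p) (Δ : LTI k p m) : Prop where
  jacobian_invertible : ∀ x w, (1 - Δ.D * jacobian (S.g x) w).det ≠ 0
  existsUnique_input : ∀ z, ∃! w, S.IsLoopInput Δ z w
  contDiffAt_field : ContDiffAt ℝ 1 (S.loopField Δ) 0

end FeedbackAttack

end

noncomputable section

namespace FeedbackAttack

/-! ### Lyapunov instability -/

/-! Put `M(s) = Δ(s) G(s)` and `s₀ = jω₀`. The two norms multiply to at most `1`, so `‖M‖ ≤ 1` on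
the closed right half plane and `1 - M` is accretive there, while `1 - M(s₀)` is singular. The
identity `det_mul_eval_charpoly_loopMatrix` expresses `det (1 - M)` through the characteristic
polynomials of the loop and of the two systems. Since the loop is well posed, this determinant does
not vanish identically near `s₀`, so the singular point is isolated.

Write `(1 - M)⁻¹ = (s - s₀)⁻ᴺ Q(s)` with `Q(s₀) ≠ 0`. Accretivity along every ray into the half
plane forces `N = 1` and `Q(s₀)` positive semidefinite (`posSemidef_residue`), so `Q(s₀)` has an
eigenvalue `κ > 0`. On the scale `s = s₀ + δ w`, `δ = ε / (1 + ε)`, a zero of `det (w - Q(s))` with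
`w ≠ 0` gives a zero of `det (1 - (1 + ε) M(s))`. At `δ = 0` the former is the characteristic
polynomial of `Q(s₀)`, and by Hurwitz its root `κ` persists as a root `w` near `κ`. Then `Re s = δ
Re w > 0`, and `s` is an eigenvalue of the perturbed loop.

An eigenvalue with positive real part excludes Lyapunov stability, for the linear loop and for any
`C¹` field linearized by it (`not_lyapunovStable_of_mem_spectrum`): a Lyapunov equation yields a
quadratic form that grows exponentially along solutions near the origin. For the nonlinear loop, the
contraction principle solves the algebraic equation, the implicit function theorem makes the
solution `C¹`, and the derivative of the closed loop at the origin is the linear loop matrix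
(`fderiv_loopField_zero`). -/

/-- Radial retraction of a normed space onto the closed ball of radius `r` around `0`. -/
def radialRetraction {E : Type*} [NormedAddCommGroup E] [NormedSpace ℝ E] (r : ℝ) (x : E) : E :=
  (r / max r ‖x‖) • x

section Instability

variable {E : Type*} [NormedAddCommGroup E] [NormedSpace ℝ E]

theorem norm_radialRetraction_le {r : ℝ} (hr : 0 < r) (x : E) : ‖radialRetraction r x‖ ≤ r := by
  have ha : 0 < max r ‖x‖ := lt_max_of_lt_left hr
  rw [radialRetraction, norm_smul, Real.norm_of_nonneg (by positivity), div_mul_eq_mul_div,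
    div_le_iff₀ ha]
  exact mul_le_mul_of_nonneg_left (le_max_right _ _) hr.le

theorem radialRetraction_of_norm_le {r : ℝ} (hr : 0 < r) {x : E} (hx : ‖x‖ ≤ r) :
    radialRetraction r x = x := by
  rw [radialRetraction, max_eq_left hx, div_self hr.ne', one_smul]

theorem lipschitzWith_radialRetraction {r : ℝ} (hr : 0 < r) :
    LipschitzWith 2 (radialRetraction r : E → E) := by
  refine LipschitzWith.of_dist_le_mul fun x y => ?_
  rw [dist_eq_norm, dist_eq_norm]
  set a := max r ‖x‖ with ha'
  set b := max r ‖y‖ with hb'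
  have ha : 0 < a := lt_max_of_lt_left hr
  have hb : 0 < b := lt_max_of_lt_left hr
  have hab : |b - a| ≤ ‖x - y‖ := by
    rw [abs_sub_comm]
    refine (abs_max_sub_max_le_max r ‖x‖ r ‖y‖).trans ?_
    simpa using abs_norm_sub_norm_le x y
  -- Move the point at a fixed scaling factor, then change the factor. Each move costs at most `‖x -
  -- y‖`, hence the constant `2`.
  have hdec : radialRetraction r x - radialRetraction r y
      = (r / a) • (x - y) + ((r / a) * ((b - a) / b)) • y := by
    have : r / a * ((b - a) / b) = r / a - r / b := by field_simp
    rw [this, radialRetraction, radialRetraction, ← ha', ← hb']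
    module
  have h1 : r / a ≤ 1 := (div_le_one ha).2 (le_max_left _ _)
  have h2 : ‖y‖ / b ≤ 1 := (div_le_one hb).2 (le_max_right _ _)
  have h3 : 0 ≤ r / a := by positivity
  rw [hdec]
  refine (norm_add_le _ _).trans ?_
  rw [norm_smul, norm_smul, norm_mul, Real.norm_of_nonneg h3, norm_div, Real.norm_eq_abs,
    Real.norm_of_nonneg hb.le]
  have h4 : r / a * (|b - a| / b) * ‖y‖ ≤ 1 * ‖x - y‖ := by
    calc r / a * (|b - a| / b) * ‖y‖ = (r / a) * (|b - a| * (‖y‖ / b)) := by ring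
      _ ≤ 1 * (‖x - y‖ * 1) := by gcongr
      _ = 1 * ‖x - y‖ := by ring
  have h5 : r / a * ‖x - y‖ ≤ 1 * ‖x - y‖ := by gcongr
  push_cast
  linarith

/-- Solutions of the vector field `F ∘ radialRetraction r` exist on every interval `[0, T]`. -/
theorem exists_solution_comp_radialRetraction [CompleteSpace E] {F : E → E} {r : ℝ}
    {K : NNReal} (hr : 0 < r) (hK : LipschitzOnWith K F (Metric.closedBall 0 r)) (h0 : F 0 = 0)
    (x₀ : E) {T : ℝ} (hT : 0 ≤ T) :
    ∃ x : ℝ → E, x 0 = x₀ ∧ IsSolutionOn (fun z => F (radialRetraction r z)) x T := by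
  have hmem : ∀ z : E, radialRetraction r z ∈ Metric.closedBall (0 : E) r := fun z => by
    simpa using norm_radialRetraction_le hr z
  have hL : 0 ≤ (K : ℝ) * r := by positivity
  -- As `F 0 = 0`, the truncated field has norm at most `K r`. A solution stays within `K r T` of
  -- `x₀` up to time `T`, so one Picard–Lindelöf step covers all of `[0, T]`.
  have hPL : IsPicardLindelof (fun _ : ℝ => fun z => F (radialRetraction r z))
      (tmin := 0) (tmax := T) ⟨0, left_mem_Icc.2 hT⟩ x₀ (⟨K * r, hL⟩ * ⟨T, hT⟩) 0
      ⟨K * r, hL⟩ (K * 2) := by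
    refine IsPicardLindelof.of_time_independent (fun z _ => ?_) ?_ ?_
    · have := hK.dist_le_mul _ (hmem z) _ (Metric.mem_closedBall_self hr.le)
      rw [h0, dist_zero_right, dist_zero_right] at this
      exact this.trans (mul_le_mul_of_nonneg_left (norm_radialRetraction_le hr z) K.2)
    · exact hK.comp (lipschitzWith_radialRetraction hr).lipschitzOnWith fun z _ => hmem z
    · simp only [sub_zero, max_eq_left hT, sub_self, NNReal.coe_zero]
      exact le_rfl
  obtain ⟨x, hx0, hx⟩ := hPL.exists_eq_forall_mem_Icc_hasDerivWithinAt₀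
  exact ⟨x, hx0, hx⟩

theorem IsSolutionOn.continuousOn {F : E → E} {x : ℝ → E} {T : ℝ} (h : IsSolutionOn F x T) :
    ContinuousOn x (Icc 0 T) := fun t ht => (h t ht).continuousWithinAt

/-- If `0` is stable, solutions starting near `0` exist for all times and stay near `0`. -/
theorem LyapunovStable.exists_solution [CompleteSpace E] {F : E → E} {r : ℝ}
    {K : NNReal} (hs : LyapunovStable F 0) (hr : 0 < r)
    (hK : LipschitzOnWith K F (Metric.closedBall 0 r)) (h0 : F 0 = 0) :
    ∃ δ > 0, ∀ x₀ : E, ‖x₀‖ < δ → ∀ T : ℝ, 0 ≤ T →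
      ∃ x : ℝ → E, x 0 = x₀ ∧ IsSolutionOn F x T ∧ ∀ t ∈ Icc 0 T, ‖x t‖ < r := by
  obtain ⟨δ, hδ, hst⟩ := hs r hr
  refine ⟨min δ r, lt_min hδ hr, fun x₀ hx₀ T hT => ?_⟩
  obtain ⟨x, hx0, hx⟩ := exists_solution_comp_radialRetraction hr hK h0 x₀ hT
  have hcont : ContinuousOn (fun t => ‖x t‖) (Icc 0 T) := hx.continuousOn.norm
  have restrict : ∀ τ ∈ Icc 0 T, (∀ t ∈ Icc 0 τ, ‖x t‖ ≤ r) → IsSolutionOn F x τ := by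
    intro τ hτ hle t ht
    have := (hx t ⟨ht.1, ht.2.trans hτ.2⟩).mono (Icc_subset_Icc_right hτ.2)
    simpa only [radialRetraction_of_norm_le hr (hle t ht)] using this
  have hlt : ∀ t ∈ Icc 0 T, ‖x t‖ < r := by
    by_contra! hcon
    obtain ⟨t₁, ht₁, hrt₁⟩ := hcon
    have hsub : Icc 0 t₁ ⊆ Icc 0 T := Icc_subset_Icc_right ht₁.2
    have hcomp : IsCompact (Icc 0 t₁ ∩ (fun t => ‖x t‖) ⁻¹' Ici r) := by
      refine isCompact_Icc.of_isClosed_subset ?_ inter_subset_left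
      exact (hcont.mono hsub).preimage_isClosed_of_isClosed isClosed_Icc isClosed_Ici
    obtain ⟨τ, ⟨hτ, hτr⟩, hleast⟩ := hcomp.exists_isLeast ⟨t₁, ⟨ht₁.1, le_rfl⟩, hrt₁⟩
    have hτT : τ ∈ Icc 0 T := hsub hτ
    -- At the first time `τ` with `‖x τ‖ ≥ r` the norm is exactly `r`. The truncation is therefore
    -- inactive on all of `[0, τ]`, and stability applied there gives `‖x τ‖ < r`, a contradiction.
    obtain ⟨σ, hσ, hσr⟩ : r ∈ (fun t => ‖x t‖) '' Icc 0 τ := by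
      refine intermediate_value_Icc hτ.1 (hcont.mono (Icc_subset_Icc_right hτT.2)) ⟨?_, hτr⟩
      simpa [hx0] using (hx₀.trans_le (min_le_right _ _)).le
    have hστ : σ = τ :=
      le_antisymm hσ.2 (hleast ⟨⟨hσ.1, hσ.2.trans hτ.2⟩, (show r ≤ ‖x σ‖ from hσr.ge)⟩)
    have hle : ∀ t ∈ Icc 0 τ, ‖x t‖ ≤ r := by
      intro t ht
      by_contra! hlt
      have := le_antisymm ht.2 (hleast ⟨⟨ht.1, ht.2.trans hτ.2⟩, (show r ≤ ‖x t‖ from hlt.le)⟩)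
      subst this
      subst hστ
      exact hlt.ne' hσr
    have := hst τ hτ.1 x (restrict τ hτT hle)
      (by simpa [hx0] using hx₀.trans_le (min_le_left _ _)) τ ⟨hτ.1, le_rfl⟩
    rw [sub_zero] at this
    exact absurd hτr (not_le.2 this)
  exact ⟨x, hx0, restrict T ⟨hT, le_rfl⟩ fun t ht => (hlt t ht).le, hlt⟩

/-- **Chetaev-type instability criterion.** A quadratic form that takes a positive value somewhere
and grows exponentially along the linearized flow rules out Lyapunov stability. -/
theorem not_lyapunovStable_of_quadratic [CompleteSpace E] {F : E → E} (hF : ContDiffAt ℝ 1 F 0)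
    (h0 : F 0 = 0) (Q : E →L[ℝ] E →L[ℝ] ℝ) (hsymm : ∀ x y, Q x y = Q y x) {β c : ℝ}
    (hβ : 0 < β) (hc : 0 < c)
    (hQ : ∀ x, 2 * β * Q x x + c * ‖x‖ ^ 2 ≤ 2 * Q x (fderiv ℝ F 0 x))
    (hpos : ∃ x, 0 < Q x x) : ¬ LyapunovStable F 0 := by
  intro hs
  obtain ⟨K, s, hsn, hK⟩ := hF.exists_lipschitzOnWith
  -- With this tolerance the linearization error changes `2 Q(x, F x)` by at most `c ‖x‖²`, which is
  -- the margin in `hQ`. The `+ 1` covers `‖Q‖ = 0`.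
  have hη : 0 < c / (2 * (‖Q‖ + 1)) := by positivity
  have hder := (hF.differentiableAt one_ne_zero).hasFDerivAt.isLittleO.def hη
  obtain ⟨r, hr, hball⟩ := Metric.nhds_basis_closedBall.mem_iff.1 (inter_mem hsn hder)
  have hgrow : ∀ x, ‖x‖ ≤ r → 2 * β * Q x x ≤ 2 * Q x (F x) := by
    intro x hx
    have hx' : ‖F x - F 0 - fderiv ℝ F 0 (x - 0)‖ ≤ c / (2 * (‖Q‖ + 1)) * ‖x - 0‖ :=
      (hball (by simpa using hx)).2
    rw [h0, sub_zero, sub_zero] at hx'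
    have h1 : Q x (F x) = Q x (fderiv ℝ F 0 x) + Q x (F x - fderiv ℝ F 0 x) := by
      rw [← map_add]; congr 1; abel
    have h2 : |Q x (F x - fderiv ℝ F 0 x)| ≤ ‖Q‖ * ‖x‖ * (c / (2 * (‖Q‖ + 1)) * ‖x‖) :=
      (Q.le_opNorm₂ x _).trans (by gcongr)
    have h3 : ‖Q‖ * ‖x‖ * (c / (2 * (‖Q‖ + 1)) * ‖x‖) ≤ c / 2 * ‖x‖ ^ 2 := by
      have : ‖Q‖ / (‖Q‖ + 1) ≤ 1 := (div_le_one (by positivity)).2 (by linarith)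
      calc ‖Q‖ * ‖x‖ * (c / (2 * (‖Q‖ + 1)) * ‖x‖)
          = (‖Q‖ / (‖Q‖ + 1)) * (c / 2 * ‖x‖ ^ 2) := by field_simp
        _ ≤ 1 * (c / 2 * ‖x‖ ^ 2) := by gcongr
        _ = c / 2 * ‖x‖ ^ 2 := one_mul _
    have := neg_abs_le (Q x (F x - fderiv ℝ F 0 x))
    linarith [hQ x]
  obtain ⟨δ, hδ, hsol⟩ :=
    hs.exists_solution hr (hK.mono fun x hx => (hball hx).1) h0
  obtain ⟨x₁, hx₁⟩ := hpos
  obtain ⟨a, ha, haδ⟩ : ∃ a : ℝ, 0 < a ∧ ‖a • x₁‖ < δ := by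
    refine ⟨δ / (‖x₁‖ + 1), by positivity, ?_⟩
    rw [norm_smul, Real.norm_of_nonneg (by positivity), div_mul_eq_mul_div,
      div_lt_iff₀ (by positivity)]
    exact mul_lt_mul_of_pos_left (by linarith) hδ
  set V₀ := Q (a • x₁) (a • x₁) with hV₀
  have hV₀pos : 0 < V₀ := by
    simp only [hV₀, map_smul, smul_apply, smul_eq_mul]
    positivity
  -- Along the solution `Q` reaches at least `V₀ exp (2βT) ≥ V₀ (1 + 2βT)`. This `T` makes `V₀ ·
  -- 2βT` equal to `‖Q‖ r²`, the bound for `Q` on the ball, so the extra `V₀` is contradictory.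
  set T := ‖Q‖ * r ^ 2 / (2 * β * V₀) with hTdef
  have hT : 0 ≤ T := by positivity
  obtain ⟨x, hx0, hx, hxr⟩ := hsol (a • x₁) haδ T hT
  have hV : ∀ t ∈ Icc 0 T, HasDerivWithinAt (fun t => Q (x t) (x t) * Real.exp (-(2 * β * t)))
      ((2 * Q (x t) (F (x t)) - 2 * β * Q (x t) (x t)) * Real.exp (-(2 * β * t))) (Icc 0 T) t := by
    intro t ht
    have h1 := hx t ht
    have h2 := (Q.hasFDerivAt.comp_hasDerivWithinAt t h1).clm_apply h1
    have h3 : HasDerivAt (fun t => Real.exp (-(2 * β * t)))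
        (Real.exp (-(2 * β * t)) * (-(2 * β * 1))) t :=
      (((hasDerivAt_id t).const_mul (2 * β)).neg).exp
    refine (h2.mul h3.hasDerivWithinAt).congr_deriv ?_
    simp only [Function.comp_apply]
    rw [hsymm (F (x t)) (x t)]
    ring
  have hmono : MonotoneOn (fun t => Q (x t) (x t) * Real.exp (-(2 * β * t))) (Icc 0 T) := by
    refine monotoneOn_of_hasDerivWithinAt_nonneg (convex_Icc 0 T)
      (fun t ht => (hV t ht).continuousWithinAt)
      (fun t ht => (hV t (interior_subset ht)).mono interior_subset) fun t ht => ?_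
    have := hgrow (x t) (hxr t (interior_subset ht)).le
    exact mul_nonneg (by linarith) (Real.exp_pos _).le
  have h1 := hmono (left_mem_Icc.2 hT) (right_mem_Icc.2 hT) hT
  simp only [mul_zero, neg_zero, Real.exp_zero, mul_one, hx0] at h1
  have h2 : Q (x T) (x T) ≤ ‖Q‖ * r ^ 2 := by
    have hb := (hxr T (right_mem_Icc.2 hT)).le
    calc Q (x T) (x T) ≤ ‖Q (x T) (x T)‖ := le_abs_self _
      _ ≤ ‖Q‖ * ‖x T‖ * ‖x T‖ := Q.le_opNorm₂ _ _
      _ ≤ ‖Q‖ * r * r := by gcongr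
      _ = ‖Q‖ * r ^ 2 := by ring
  have h3 : V₀ * Real.exp (2 * β * T) ≤ ‖Q‖ * r ^ 2 := by
    have : V₀ * Real.exp (2 * β * T)
        ≤ Q (x T) (x T) * Real.exp (-(2 * β * T)) * Real.exp (2 * β * T) := by gcongr
    rw [mul_assoc (Q (x T) (x T)), ← Real.exp_add, neg_add_cancel, Real.exp_zero, mul_one] at this
    exact this.trans h2
  have h4 : V₀ * (2 * β * T + 1) ≤ V₀ * Real.exp (2 * β * T) := by
    gcongr
    exact Real.add_one_le_exp _
  have h5 : V₀ * (2 * β * T) = ‖Q‖ * r ^ 2 := by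
    rw [hTdef]; field_simp
  nlinarith

end Instability

/-! ### Quadratic forms growing along an unstable linear flow -/

theorem dotProduct_mulVec_comm_of_transpose_eq {ι : Type*} [Fintype ι] {H : Matrix ι ι ℝ}
    (hH : Hᵀ = H) (x y : ι → ℝ) : x ⬝ᵥ H *ᵥ y = y ⬝ᵥ H *ᵥ x := by
  rw [Matrix.dotProduct_mulVec, ← Matrix.mulVec_transpose, hH, dotProduct_comm]

section Sylvester

variable {ι : Type*} [Fintype ι] [DecidableEq ι]

/-- Lets the Sylvester equation, read as `X (-N) = Nᵀ X`, pass to polynomials so that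
Cayley–Hamilton can be applied. -/
theorem semiconjBy_aeval {R A : Type*} [CommSemiring R] [Semiring A] [Algebra R A] {x a b : A}
    (h : SemiconjBy x a b) (p : Polynomial R) :
    SemiconjBy x (Polynomial.aeval a p) (Polynomial.aeval b p) := by
  induction p using Polynomial.induction_on' with
  | add p q hp hq => simpa only [map_add] using hp.add_right hq
  | monomial n r =>
    simp only [Polynomial.aeval_monomial]
    exact SemiconjBy.mul_right (Algebra.commutes r x).symm (h.pow_right n)

/-- The Sylvester equation `Nᵀ X + X N = 0` has only the trivial solution if `N` and `-N` have no
common eigenvalue. -/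
theorem eq_zero_of_transpose_mul_add_mul_eq_zero {N X : Matrix ι ι ℂ}
    (hN : ∀ ν ∈ spectrum ℂ N, -ν ∉ spectrum ℂ N) (h : Nᵀ * X + X * N = 0) : X = 0 := by
  cases isEmpty_or_nonempty ι
  · exact Subsingleton.elim _ _
  have hsc : SemiconjBy X (-N) Nᵀ := by
    rw [SemiconjBy, mul_neg, neg_eq_iff_add_eq_zero, add_comm]
    exact h
  -- For the characteristic polynomial `χ` of `N`, `X χ(-N) = χ(Nᵀ) X = 0` by Cayley–Hamilton, and
  -- `χ(-N)` is invertible because no eigenvalue of `-N` is a root of `χ`.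
  have h1 := (semiconjBy_aeval hsc N.charpoly).eq
  rw [← Matrix.charpoly_transpose, Matrix.aeval_self_charpoly, zero_mul,
    Matrix.charpoly_transpose] at h1
  have hne : (spectrum ℂ (-N)).Nonempty := spectrum.nonempty_of_isAlgClosed_of_finiteDimensional ℂ _
  have hu : IsUnit (Polynomial.aeval (-N) N.charpoly) := by
    rw [← spectrum.zero_notMem_iff ℂ, spectrum.map_polynomial_aeval_of_nonempty _ _ hne]
    rintro ⟨ν, hν, hν0⟩
    rw [← spectrum.neg_eq, Set.mem_neg] at hν
    have : ν ∈ spectrum ℂ N := Matrix.mem_spectrum_iff_isRoot_charpoly.2 hν0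
    exact hN ν this hν
  exact (hu.mul_left_eq_zero).1 h1

/-- The Lyapunov equation `Nᵀ H + H N = 2` has a symmetric solution if `N` and `-N` have no common
eigenvalue. -/
theorem exists_lyapunov_solution {N : Matrix ι ι ℝ}
    (hN : ∀ ν ∈ spectrum ℂ (N.map Complex.ofReal), -ν ∉ spectrum ℂ (N.map Complex.ofReal)) :
    ∃ H : Matrix ι ι ℝ, Hᵀ = H ∧ Nᵀ * H + H * N = 2 • (1 : Matrix ι ι ℝ) := by
  let T : Matrix ι ι ℝ →ₗ[ℝ] Matrix ι ι ℝ := LinearMap.mulLeft ℝ Nᵀ + LinearMap.mulRight ℝ N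
  have hT : Function.Injective T := by
    refine (injective_iff_map_eq_zero T).2 fun X hX => ?_
    have hX' : Nᵀ * X + X * N = 0 := hX
    have h1 := congrArg (fun Y : Matrix ι ι ℝ => Y.map Complex.ofRealHom) hX'
    simp only [Matrix.map_add _ (map_add Complex.ofRealHom), Matrix.map_mul,
      Matrix.map_zero _ (map_zero Complex.ofRealHom)] at h1
    have h2 := eq_zero_of_transpose_mul_add_mul_eq_zero hN h1
    ext i j
    simpa using congrFun (congrFun h2 i) j
  obtain ⟨X, hX⟩ := LinearMap.injective_iff_surjective.1 hT 1
  have hX : Nᵀ * X + X * N = 1 := hX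
  -- Symmetrizing a solution for right-hand side `1` doubles that side, which explains the `2`.
  refine ⟨X + Xᵀ, by rw [Matrix.transpose_add, Matrix.transpose_transpose, add_comm], ?_⟩
  have hX2 := congrArg Matrix.transpose hX
  rw [Matrix.transpose_add, Matrix.transpose_mul, Matrix.transpose_mul, Matrix.transpose_transpose,
    Matrix.transpose_one] at hX2
  rw [Matrix.mul_add, Matrix.add_mul, two_smul]
  nth_rw 1 [← hX]
  rw [← hX2]
  abel

theorem exists_real_imag_eigenvectors {M : Matrix ι ι ℝ} {μ : ℂ}
    (hμ : μ ∈ spectrum ℂ (M.map Complex.ofReal)) :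
    ∃ a b : ι → ℝ, (a ≠ 0 ∨ b ≠ 0) ∧ M *ᵥ a = μ.re • a - μ.im • b ∧
      M *ᵥ b = μ.im • a + μ.re • b := by
  rw [Matrix.mem_spectrum_iff_isRoot_charpoly, Polynomial.IsRoot, Matrix.eval_charpoly,
    ← Matrix.exists_mulVec_eq_zero_iff] at hμ
  obtain ⟨v, hv, hMv⟩ := hμ
  rw [Matrix.sub_mulVec, sub_eq_zero] at hMv
  have hi : ∀ i, μ * v i = ∑ j, (M i j : ℂ) * v j := fun i => by
    have := congrFun hMv i
    rwa [Matrix.scalar_apply, Matrix.mulVec_diagonal] at this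
  refine ⟨fun i => (v i).re, fun i => (v i).im, ?_, ?_, ?_⟩
  · by_contra! h
    refine hv (funext fun i => Complex.ext ?_ ?_)
    · exact congrFun h.1 i
    · exact congrFun h.2 i
  · ext i
    have := congrArg Complex.re (hi i)
    simp only [Complex.mul_re, Complex.re_sum, Complex.ofReal_re, Complex.ofReal_im, zero_mul,
      sub_zero] at this
    simpa [Matrix.mulVec, dotProduct] using this.symm
  · ext i
    have := congrArg Complex.im (hi i)
    simp only [Complex.mul_im, Complex.im_sum, Complex.ofReal_re, Complex.ofReal_im, zero_mul,
      add_zero] at this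
    simp only [Matrix.mulVec, dotProduct, Pi.add_apply, Pi.smul_apply, smul_eq_mul]
    linarith

/-- If `M` has an eigenvalue with positive real part, then some quadratic form that is positive
somewhere grows exponentially along the flow of `M`. -/
theorem exists_growing_quadratic_form {M : Matrix ι ι ℝ} {μ : ℂ}
    (hμ : μ ∈ spectrum ℂ (M.map Complex.ofReal)) (hre : 0 < μ.re) :
    ∃ β : ℝ, 0 < β ∧ ∃ H : Matrix ι ι ℝ, Hᵀ = H ∧
      (∀ x, x ⬝ᵥ H *ᵥ (M *ᵥ x) = β * (x ⬝ᵥ H *ᵥ x) + x ⬝ᵥ x) ∧ ∃ x, 0 < x ⬝ᵥ H *ᵥ x := by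
  set σ := spectrum ℂ (M.map Complex.ofReal) with hσ
  -- Eigenvalues `ν` and `-ν` of `M - β` would be shifts of eigenvalues of `M` with sum `2β`. Only
  -- finitely many `β` allow this.
  have hfin : (Set.image2 (fun a b : ℂ => (a + b).re / 2) σ σ).Finite :=
    (Matrix.finite_spectrum _).image2 _ (Matrix.finite_spectrum _)
  obtain ⟨β, ⟨hβ0, hβμ⟩, hβ⟩ := ((Ioo_infinite hre).sdiff hfin).nonempty
  set N := M - β • (1 : Matrix ι ι ℝ) with hNdef
  have hspec : ∀ ν, ν ∈ spectrum ℂ (N.map Complex.ofReal) → ν + β ∈ σ := by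
    intro ν hν
    rw [hσ, spectrum.add_mem_iff]
    have : -(algebraMap ℂ (Matrix ι ι ℂ)) β + M.map Complex.ofReal = N.map Complex.ofReal := by
      ext i j
      by_cases hij : i = j <;>
        simp [hNdef, Matrix.algebraMap_matrix_apply, hij, sub_eq_neg_add]
    rwa [this]
  obtain ⟨H, hH, hLyap⟩ := exists_lyapunov_solution (N := N) fun ν hν hν' => hβ
    ⟨_, hspec _ hν, _, hspec _ hν', by simp; ring⟩
  have hquad : ∀ x, x ⬝ᵥ H *ᵥ (N *ᵥ x) = x ⬝ᵥ x := by
    intro x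
    have h1 := congrArg (fun Y => x ⬝ᵥ Y *ᵥ x) hLyap
    simp only [Matrix.add_mulVec, dotProduct_add, Matrix.smul_mulVec, Matrix.one_mulVec,
      ← Matrix.mulVec_mulVec, dotProduct_smul] at h1
    rw [Matrix.dotProduct_mulVec x Nᵀ, Matrix.vecMul_transpose,
      dotProduct_mulVec_comm_of_transpose_eq hH, ← two_nsmul] at h1
    simpa using h1
  have hM : ∀ x, x ⬝ᵥ H *ᵥ (M *ᵥ x) = β * (x ⬝ᵥ H *ᵥ x) + x ⬝ᵥ x := by
    intro x
    have : M = N + β • (1 : Matrix ι ι ℝ) := by rw [hNdef, sub_add_cancel]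
    rw [this, Matrix.add_mulVec, Matrix.mulVec_add, dotProduct_add, hquad, Matrix.smul_mulVec,
      Matrix.one_mulVec, Matrix.mulVec_smul, dotProduct_smul, smul_eq_mul, add_comm]
  refine ⟨β, hβ0, H, hH, hM, ?_⟩
  -- Adding the growth identities for the real and imaginary parts cancels the cross terms in `μ.im`
  -- and leaves `(μ.re - β)(aᵀHa + bᵀHb) = |a|² + |b|² > 0`. Hence one of the two values is
  -- positive.
  obtain ⟨a, b, hab, ha, hb⟩ := exists_real_imag_eigenvectors hμ
  have h1 := hM a
  have h2 := hM b
  rw [ha, Matrix.mulVec_sub, dotProduct_sub, Matrix.mulVec_smul, Matrix.mulVec_smul,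
    dotProduct_smul, dotProduct_smul, smul_eq_mul, smul_eq_mul] at h1
  rw [hb, Matrix.mulVec_add, dotProduct_add, Matrix.mulVec_smul, Matrix.mulVec_smul,
    dotProduct_smul, dotProduct_smul, smul_eq_mul, smul_eq_mul,
    dotProduct_mulVec_comm_of_transpose_eq hH b a] at h2
  have h3 : 0 < a ⬝ᵥ a + b ⬝ᵥ b := by
    have ha0 : 0 ≤ a ⬝ᵥ a := dotProduct_self_star_nonneg a
    have hb0 : 0 ≤ b ⬝ᵥ b := dotProduct_self_star_nonneg b
    rcases hab with h | h
    · exact add_pos_of_pos_of_nonneg (ha0.lt_of_ne' (by simpa using h)) hb0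
    · exact add_pos_of_nonneg_of_pos ha0 (hb0.lt_of_ne' (by simpa using h))
  have h4 : 0 < (μ.re - β) * (a ⬝ᵥ H *ᵥ a + b ⬝ᵥ H *ᵥ b) := by linarith
  have h5 := (pos_iff_pos_of_mul_pos h4).1 (by linarith)
  by_contra! hcon
  linarith [hcon a, hcon b]

/-- **Lyapunov's indirect method (instability).** If the linearization of a `C¹` vector field at an
equilibrium has, in suitable linear coordinates, a matrix with an eigenvalue of positive real part,
then the equilibrium is not Lyapunov stable. -/
theorem not_lyapunovStable_of_mem_spectrum {E : Type*} [NormedAddCommGroup E] [NormedSpace ℝ E]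
    {F : E → E} (hF : ContDiffAt ℝ 1 F 0) (h0 : F 0 = 0) (e : E ≃L[ℝ] (ι → ℝ))
    {M : Matrix ι ι ℝ} (hM : ∀ x, e (fderiv ℝ F 0 x) = M *ᵥ e x) {μ : ℂ}
    (hμ : μ ∈ spectrum ℂ (M.map Complex.ofReal)) (hre : 0 < μ.re) : ¬ LyapunovStable F 0 := by
  have : FiniteDimensional ℝ E := e.symm.toLinearEquiv.finiteDimensional
  have : CompleteSpace E := FiniteDimensional.complete ℝ E
  obtain ⟨β, hβ, H, hH, hgrow, x₁, hx₁⟩ := exists_growing_quadratic_form hμ hre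
  let Q : E →L[ℝ] E →L[ℝ] ℝ := LinearMap.toContinuousBilinearMap
    (((Matrix.toLinearMap₂' ℝ H).compl₁₂ e.toLinearEquiv.toLinearMap e.toLinearEquiv.toLinearMap))
  have hQ : ∀ x y, Q x y = e x ⬝ᵥ H *ᵥ e y := fun x y => Matrix.toLinearMap₂'_apply' H _ _
  set C := ‖(e.symm : (ι → ℝ) →L[ℝ] E)‖ with hC
  -- The growth identity leaves the surplus `2 |e x|²`, and `‖x‖² ≤ C² |e x|²` turns it into a
  -- multiple of `‖x‖²`. The `+ 1` in the constant keeps it well defined and positive when `C = 0`.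
  refine not_lyapunovStable_of_quadratic hF h0 Q (fun x y => ?_) hβ
    (c := 2 / (C ^ 2 + 1)) (by positivity) (fun x => ?_) ⟨e.symm x₁, ?_⟩
  · rw [hQ, hQ, dotProduct_mulVec_comm_of_transpose_eq hH]
  · rw [hQ, hQ, hM, hgrow]
    have h1 : ‖x‖ ≤ C * ‖e x‖ := by
      simpa using (e.symm : (ι → ℝ) →L[ℝ] E).le_opNorm (e x)
    have h2 : ‖e x‖ ^ 2 ≤ e x ⬝ᵥ e x := by
      have hnn : 0 ≤ e x ⬝ᵥ e x := dotProduct_self_star_nonneg (e x)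
      rw [← Real.le_sqrt (norm_nonneg _) hnn, pi_norm_le_iff_of_nonneg (Real.sqrt_nonneg _)]
      refine fun i => Real.abs_le_sqrt ?_
      rw [pow_two]
      exact Finset.single_le_sum (f := fun i => e x i * e x i)
        (fun j _ => mul_self_nonneg _) (Finset.mem_univ i)
    have h3 : 2 / (C ^ 2 + 1) * ‖x‖ ^ 2 ≤ 2 * (e x ⬝ᵥ e x) := by
      rw [div_mul_eq_mul_div, div_le_iff₀ (by positivity)]
      have : ‖x‖ ^ 2 ≤ C ^ 2 * ‖e x‖ ^ 2 := by
        rw [← mul_pow]; gcongr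
      nlinarith [sq_nonneg C, sq_nonneg ‖e x‖]
    linarith
  · simpa [hQ] using hx₁

end Sylvester

/-! ### Zeros of `det (1 - (1 + ε) M(s))` in the right half plane -/

/-- **Persistence of zeros** (Hurwitz) for a continuous family of holomorphic functions. -/
theorem eventually_exists_zero {F : ℝ → ℂ → ℂ} {κ : ℂ} {r : ℝ} (hr : 0 < r)
    (hcont : ∀ w ∈ Metric.closedBall κ r, ContinuousAt (fun p : ℝ × ℂ => F p.1 p.2) (0, w))
    (hdiff : ∀ w ∈ Metric.closedBall κ r, ∀ᶠ p : ℝ × ℂ in 𝓝 (0, w), DifferentiableAt ℂ (F p.1) p.2)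
    (h0 : F 0 κ = 0) (hsphere : ∀ w ∈ Metric.sphere κ r, F 0 w ≠ 0) :
    ∀ᶠ δ in 𝓝 (0 : ℝ), ∃ w ∈ Metric.closedBall κ r, F δ w = 0 := by
  have hc0 : ContinuousOn (fun w => ‖F 0 w‖) (Metric.sphere κ r) := fun w hw =>
    ((hcont w (Metric.sphere_subset_closedBall hw)).comp
      (f := fun w : ℂ => ((0 : ℝ), w)) (by fun_prop)).norm.continuousWithinAt
  obtain ⟨w₁, hw₁, hmin⟩ := (isCompact_sphere κ r).exists_isMinOn
    (NormedSpace.sphere_nonempty.2 hr.le) hc0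
  set m := ‖F 0 w₁‖ with hm
  have hmpos : 0 < m := norm_pos_iff.2 (hsphere w₁ hw₁)
  have e1 : ∀ᶠ δ in 𝓝 (0 : ℝ), ∀ w ∈ Metric.sphere κ r, m / 2 < ‖F δ w‖ := by
    refine (isCompact_sphere κ r).eventually_forall_of_forall_eventually fun w hw => ?_
    have hlt : m / 2 < ‖F 0 w‖ := (half_lt_self hmpos).trans_le (hmin hw)
    exact (hcont w (Metric.sphere_subset_closedBall hw)).norm.eventually (lt_mem_nhds hlt)
  have e2 : ∀ᶠ δ in 𝓝 (0 : ℝ), ∀ w ∈ Metric.closedBall κ r, DifferentiableAt ℂ (F δ) w :=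
    (isCompact_closedBall κ r).eventually_forall_of_forall_eventually hdiff
  have e3 : ∀ᶠ δ in 𝓝 (0 : ℝ), ‖F δ κ‖ < m / 2 := by
    have := ((hcont κ (Metric.mem_closedBall_self hr.le)).comp
      (f := fun δ : ℝ => (δ, κ)) (by fun_prop)).norm
    refine this.eventually (gt_mem_nhds ?_)
    simpa [h0] using hmpos
  filter_upwards [e1, e2, e3] with δ h1 h2 h3
  -- Without zeros `1 / F δ` is holomorphic on the disc. It is smaller than `2 / m` on the circle
  -- but larger at the centre, against the maximum principle.
  by_contra! hne
  have hd : DiffContOnCl ℂ (fun w => (F δ w)⁻¹) (Metric.ball κ r) := by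
    refine DifferentiableOn.diffContOnCl fun w hw => ?_
    rw [closure_ball κ hr.ne'] at hw
    exact ((h2 w hw).inv (hne w hw)).differentiableWithinAt
  have hb : ‖(F δ κ)⁻¹‖ ≤ (m / 2)⁻¹ := by
    refine Complex.norm_le_of_forall_mem_frontier_norm_le Metric.isBounded_ball hd
      (fun z hz => ?_) (subset_closure (Metric.mem_ball_self hr))
    rw [frontier_ball κ hr.ne'] at hz
    rw [norm_inv]
    exact inv_anti₀ (by positivity) (h1 z hz).le
  have hpos : 0 < ‖F δ κ‖ := norm_pos_iff.2 (hne κ (Metric.mem_closedBall_self hr.le))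
  rw [norm_inv, inv_le_inv₀ hpos (by positivity)] at hb
  linarith

theorem continuousAt_matrix {ι X : Type*} [TopologicalSpace X] {M : X → Matrix ι ι ℂ} {x : X}
    (hM : ∀ i j, ContinuousAt (fun s => M s i j) x) : ContinuousAt M x :=
  continuousAt_pi.2 fun i => continuousAt_pi.2 fun j => hM i j

section MatrixFunctions

variable {ι : Type*} [Fintype ι] [DecidableEq ι]

theorem analyticAt_det {M : ℂ → Matrix ι ι ℂ} {s₀ : ℂ}
    (hM : ∀ i j, AnalyticAt ℂ (fun s => M s i j) s₀) : AnalyticAt ℂ (fun s => (M s).det) s₀ := by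
  simp only [Matrix.det_apply']
  exact Finset.analyticAt_fun_sum _ fun σ _ =>
    analyticAt_const.mul (Finset.analyticAt_fun_prod _ fun i _ => hM _ _)

theorem analyticAt_adjugate {M : ℂ → Matrix ι ι ℂ} {s₀ : ℂ}
    (hM : ∀ i j, AnalyticAt ℂ (fun s => M s i j) s₀) (i j : ι) :
    AnalyticAt ℂ (fun s => (M s).adjugate i j) s₀ := by
  simp only [Matrix.adjugate_apply]
  refine analyticAt_det fun k l => ?_
  simp only [Matrix.updateRow_apply]
  split_ifs
  · exact analyticAt_const
  · exact hM k l

/-- Pole expansion of the inverse of an analytic matrix function at an isolated singular point: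
`(M s)⁻¹ = (s - s₀)⁻ᴺ Q(s)` with `N ≥ 1` and `Q s₀ ≠ 0`. -/
theorem exists_mul_eq_pow_smul_one {M : ℂ → Matrix ι ι ℂ} {s₀ : ℂ}
    (hM : ∀ i j, AnalyticAt ℂ (fun s => M s i j) s₀) (h0 : (M s₀).det = 0)
    (hne : ∀ᶠ s in 𝓝[≠] s₀, (M s).det ≠ 0) :
    ∃ (N : ℕ) (Q : ℂ → Matrix ι ι ℂ), 1 ≤ N ∧ (∀ i j, AnalyticAt ℂ (fun s => Q s i j) s₀) ∧
      Q s₀ ≠ 0 ∧ ∀ᶠ s in 𝓝 s₀, M s * Q s = (s - s₀) ^ N • (1 : Matrix ι ι ℂ) := by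
  have hι : Nonempty ι := by
    by_contra h
    rw [not_nonempty_iff] at h
    simp at h0
  have hdet : ¬ ∀ᶠ s in 𝓝 s₀, (M s).det = 0 := fun h => by
    obtain ⟨s, hs, hs'⟩ := (hne.and (h.filter_mono nhdsWithin_le_nhds)).exists
    exact hs hs'
  obtain ⟨a, u, hu, hu0, hua⟩ :=
    (analyticAt_det hM).exists_eventuallyEq_pow_smul_nonzero_iff.2 hdet
  -- Factoring the adjugate as one vector-valued function removes exactly the order of vanishing
  -- common to all entries, so the quotient is nonzero at `s₀`.
  let adj : ℂ → ι → ι → ℂ := fun s => (M s).adjugate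
  have hadj : AnalyticAt ℂ adj s₀ :=
    analyticAt_pi_iff.2 fun i => analyticAt_pi_iff.2 fun j => analyticAt_adjugate hM i j
  have hadj0 : ¬ ∀ᶠ s in 𝓝 s₀, adj s = 0 := fun h => by
    refine hdet (h.mono fun s hs => ?_)
    have h1 := Matrix.mul_adjugate (M s)
    rw [show (M s).adjugate = 0 from hs, mul_zero] at h1
    obtain ⟨i⟩ := hι
    simpa using (congrFun (congrFun h1 i) i).symm
  obtain ⟨b, A, hA, hA0, hAb⟩ := hadj.exists_eventuallyEq_pow_smul_nonzero_iff.2 hadj0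
  have hA' : ∀ i j, AnalyticAt ℂ (fun s => (Matrix.of (A s)) i j) s₀ := fun i j =>
    analyticAt_pi_iff.1 (analyticAt_pi_iff.1 hA i) j
  have hMc : ContinuousAt M s₀ := continuousAt_matrix fun i j => (hM i j).continuousAt
  have hAc : ContinuousAt (fun s => Matrix.of (A s)) s₀ :=
    continuousAt_matrix fun i j => (hA' i j).continuousAt
  have hkey : ∀ᶠ s in 𝓝 s₀,
      (s - s₀) ^ b • (M s * Matrix.of (A s)) = ((s - s₀) ^ a * u s) • (1 : Matrix ι ι ℂ) := by
    filter_upwards [hua, hAb] with s h1 h2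
    rw [← smul_eq_mul ((s - s₀) ^ a), ← h1, ← Matrix.mul_adjugate, ← Matrix.mul_smul]
    congr 1
    exact h2.symm
  -- If `a ≤ b`, dividing by `(s - s₀)ᵃ` and letting `s → s₀` would give the singular `M s₀` a right
  -- inverse up to the nonzero factor `u s₀`.
  have hab : b < a := by
    by_contra! hle
    have h1 : (fun s => (s - s₀) ^ (b - a) • (M s * Matrix.of (A s))) =ᶠ[𝓝[≠] s₀]
        fun s => u s • (1 : Matrix ι ι ℂ) := by
      filter_upwards [hkey.filter_mono nhdsWithin_le_nhds, self_mem_nhdsWithin] with s hs hss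
      have hz : (s - s₀) ^ a ≠ 0 := pow_ne_zero _ (sub_ne_zero.2 hss)
      rw [← Nat.add_sub_cancel' hle, pow_add, mul_smul, mul_smul] at hs
      exact smul_right_injective _ hz hs
    have h2 := (ContinuousAt.eventuallyEq_nhds_iff_eventuallyEq_nhdsNE
      (by fun_prop) (hu.continuousAt.smul continuousAt_const)).1 h1
    have h3 : M s₀ * ((s₀ - s₀) ^ (b - a) • Matrix.of (A s₀)) = u s₀ • (1 : Matrix ι ι ℂ) := by
      rw [Matrix.mul_smul]; exact h2.eq_of_nhds
    have h4 := congrArg Matrix.det h3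
    rw [Matrix.det_mul, h0, zero_mul, Matrix.det_smul, Matrix.det_one, mul_one] at h4
    exact pow_ne_zero _ hu0 h4.symm
  refine ⟨a - b, fun s => (u s)⁻¹ • Matrix.of (A s), Nat.sub_pos_of_lt hab, fun i j => ?_, ?_, ?_⟩
  · exact (hu.inv hu0).mul (hA' i j)
  · exact smul_ne_zero (inv_ne_zero hu0) hA0
  · have huc : ContinuousAt (fun s => (u s)⁻¹) s₀ := hu.continuousAt.inv₀ hu0
    refine (ContinuousAt.eventuallyEq_nhds_iff_eventuallyEq_nhdsNE (by fun_prop)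
      (by fun_prop)).1 ?_
    filter_upwards [hkey.filter_mono nhdsWithin_le_nhds, self_mem_nhdsWithin,
      (hu.continuousAt.eventually_ne hu0).filter_mono nhdsWithin_le_nhds] with s hs hss hus
    have hz : (s - s₀) ^ b ≠ 0 := pow_ne_zero _ (sub_ne_zero.2 hss)
    rw [← Nat.add_sub_cancel' hab.le, pow_add, mul_assoc, mul_smul _ _ (1 : Matrix ι ι ℂ)] at hs
    have h5 := smul_right_injective _ hz hs
    beta_reduce at h5
    rw [Matrix.mul_smul, h5, smul_smul, mul_comm ((s - s₀) ^ (a - b)), ← mul_assoc,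
      inv_mul_cancel₀ hus, one_mul]

/-- `1 - M` is accretive if `M` is a contraction. -/
theorem re_star_dotProduct_one_sub_mulVec_nonneg {M : Matrix ι ι ℂ} (hM : ‖M‖ ≤ 1) (y : ι → ℂ) :
    0 ≤ (star y ⬝ᵥ ((1 - M) *ᵥ y)).re := by
  have h1 : star y ⬝ᵥ ((1 - M) *ᵥ y) = inner ℂ (WithLp.toLp 2 y) (WithLp.toLp 2 y)
      - inner ℂ (WithLp.toLp 2 y) (WithLp.toLp 2 (M *ᵥ y)) := by
    rw [EuclideanSpace.inner_toLp_toLp, EuclideanSpace.inner_toLp_toLp, Matrix.sub_mulVec,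
      Matrix.one_mulVec, dotProduct_sub, dotProduct_comm y, dotProduct_comm (M *ᵥ y)]
  have h2 : ‖(WithLp.toLp 2 (M *ᵥ y) : EuclideanSpace ℂ ι)‖
      ≤ ‖(WithLp.toLp 2 y : EuclideanSpace ℂ ι)‖ :=
    (Matrix.l2_opNorm_mulVec M (WithLp.toLp 2 y)).trans
      (mul_le_of_le_one_left (norm_nonneg _) hM)
  have h3 : (inner ℂ (WithLp.toLp 2 y) (WithLp.toLp 2 (M *ᵥ y)) : ℂ).re
      ≤ ‖(WithLp.toLp 2 y : EuclideanSpace ℂ ι)‖ * ‖(WithLp.toLp 2 y : EuclideanSpace ℂ ι)‖ :=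
    ((Complex.re_le_norm _).trans (norm_inner_le_norm _ _)).trans (by gcongr)
  have h4 : (inner ℂ (WithLp.toLp 2 y : EuclideanSpace ℂ ι) (WithLp.toLp 2 y) : ℂ).re
      = ‖(WithLp.toLp 2 y : EuclideanSpace ℂ ι)‖ * ‖(WithLp.toLp 2 y : EuclideanSpace ℂ ι)‖ := by
    rw [← real_inner_self_eq_norm_mul_norm]
    simp [inner_self_eq_norm_sq_to_K, ← Complex.ofReal_pow]
  rw [h1, Complex.sub_re, h4]
  linarith

end MatrixFunctions

/-- If `Re (cᴺ k) ≥ 0` for all `c` in the right half plane, then `k ≥ 0`, and `k = 0` unless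
`N = 1`. -/
theorem nonneg_of_forall_re_pow_mul_nonneg {N : ℕ} (hN : 1 ≤ N) {k : ℂ}
    (h : ∀ c : ℂ, 0 ≤ c.re → 0 ≤ (c ^ N * k).re) : k.im = 0 ∧ 0 ≤ k.re ∧ (2 ≤ N → k = 0) := by
  have hN0 : (N : ℂ) ≠ 0 := by exact_mod_cast (by omega : N ≠ 0)
  have hNr : (1 : ℝ) ≤ N := by exact_mod_cast hN
  have key : ∀ θ : ℝ, |θ| ≤ Real.pi / 2 → 0 ≤ (Complex.exp (N * (θ * Complex.I)) * k).re := by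
    intro θ hθ
    have := h (Complex.exp (θ * Complex.I)) (by
      rw [Complex.exp_ofReal_mul_I_re]
      exact Real.cos_nonneg_of_neg_pi_div_two_le_of_le (neg_le_of_abs_le hθ) (le_of_abs_le hθ))
    rwa [← Complex.exp_nat_mul] at this
  have hπ := Real.pi_pos
  have h1 := h 1 (by simp)
  have hle : |Real.pi / (2 * N)| ≤ Real.pi / 2 := by
    rw [abs_of_nonneg (by positivity)]
    exact div_le_div_of_nonneg_left hπ.le (by norm_num) (by linarith)
  -- The angles `±π / (2N)` give `cᴺ = ±i`, which bounds `k.im` from both sides by `0`.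
  have h2 := key (Real.pi / (2 * N)) hle
  have h3 := key (-(Real.pi / (2 * N))) (by rwa [abs_neg])
  have e2 : (N : ℂ) * ((Real.pi / (2 * N) : ℝ) * Complex.I) = Real.pi / 2 * Complex.I := by
    push_cast; field_simp
  have e3 : (N : ℂ) * ((-(Real.pi / (2 * N)) : ℝ) * Complex.I) = -Real.pi / 2 * Complex.I := by
    push_cast; field_simp
  rw [e2, Complex.exp_pi_div_two_mul_I] at h2
  rw [e3, Complex.exp_neg_pi_div_two_mul_I] at h3
  simp only [one_pow, one_mul] at h1
  simp at h2 h3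
  have him : k.im = 0 := by linarith
  refine ⟨him, h1, fun hN2 => ?_⟩
  have hN2r : (2 : ℝ) ≤ N := by exact_mod_cast hN2
  -- For `N ≥ 2` the angle `π / N` is admissible and gives `cᴺ = -1`, so `k.re ≤ 0` as well.
  have h4 := key (Real.pi / N) (by
    rw [abs_of_nonneg (by positivity)]
    exact div_le_div_of_nonneg_left hπ.le (by norm_num) hN2r)
  have e4 : (N : ℂ) * ((Real.pi / N : ℝ) * Complex.I) = Real.pi * Complex.I := by
    push_cast; field_simp
  rw [e4, Complex.exp_pi_mul_I] at h4
  simp at h4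
  exact Complex.ext (by simp; linarith) him

section PositiveReal

open scoped ComplexOrder

variable {ι : Type*} [Fintype ι] [DecidableEq ι] {M Q : ℂ → Matrix ι ι ℂ} {s₀ : ℂ} {N : ℕ}

/-- Test accretivity of `1 - M` on `y = Q(s) v` at `s = s₀ + t c`: there `(1 - M) y = (t c)ᴺ v`.
Divide by `tᴺ` and let `t → 0⁺`; the ray stays in the closed half plane since `Re c ≥ 0`. -/
theorem re_pow_mul_star_dotProduct_nonneg (hs₀ : s₀.re = 0) (hM : ∀ s : ℂ, 0 ≤ s.re → ‖M s‖ ≤ 1)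
    (hQ : ContinuousAt Q s₀)
    (hMQ : ∀ᶠ s in 𝓝 s₀, (1 - M s) * Q s = (s - s₀) ^ N • (1 : Matrix ι ι ℂ))
    (v : ι → ℂ) (c : ℂ) (hc : 0 ≤ c.re) : 0 ≤ (c ^ N * (star (Q s₀ *ᵥ v) ⬝ᵥ v)).re := by
  have hpath : Tendsto (fun t : ℝ => s₀ + t * c) (𝓝[>] 0) (𝓝 s₀) := by
    have : ContinuousAt (fun t : ℝ => s₀ + t * c) 0 := by fun_prop
    simpa using this.tendsto.mono_left nhdsWithin_le_nhds
  have hq : ContinuousAt (fun s => (c ^ N * (star (Q s *ᵥ v) ⬝ᵥ v)).re) s₀ := by fun_prop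
  refine ge_of_tendsto (hq.tendsto.comp hpath) ?_
  filter_upwards [hpath.eventually hMQ, self_mem_nhdsWithin] with t ht ht0
  have ht0 : 0 < t := ht0
  have hre : 0 ≤ (s₀ + t * c).re := by
    simp only [Complex.add_re, hs₀, Complex.re_ofReal_mul, zero_add]
    positivity
  have h1 := re_star_dotProduct_one_sub_mulVec_nonneg (hM _ hre) (Q (s₀ + t * c) *ᵥ v)
  rw [Matrix.mulVec_mulVec, ht, Matrix.smul_mulVec, Matrix.one_mulVec, dotProduct_smul,
    add_sub_cancel_left, mul_pow, smul_eq_mul, mul_assoc, ← Complex.ofReal_pow,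
    Complex.re_ofReal_mul] at h1
  exact nonneg_of_mul_nonneg_right h1 (by positivity)

/-- The pole of `(1 - M)⁻¹` at a boundary point is simple and has a positive semidefinite residue. -/
theorem posSemidef_residue (hs₀ : s₀.re = 0) (hM : ∀ s : ℂ, 0 ≤ s.re → ‖M s‖ ≤ 1)
    (hQ : ContinuousAt Q s₀) (hN : 1 ≤ N) (hQ0 : Q s₀ ≠ 0)
    (hMQ : ∀ᶠ s in 𝓝 s₀, (1 - M s) * Q s = (s - s₀) ^ N • (1 : Matrix ι ι ℂ)) :
    N = 1 ∧ (Q s₀).PosSemidef := by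
  have hk := fun v : ι → ℂ => nonneg_of_forall_re_pow_mul_nonneg hN
    (re_pow_mul_star_dotProduct_nonneg hs₀ hM hQ hMQ v)
  have hpsd : (Q s₀).PosSemidef := by
    -- Over `ℂ` a real-valued quadratic form is automatically Hermitian, so real nonnegative values
    -- suffice.
    rw [← Matrix.isPositive_toEuclideanLin_iff, LinearMap.isPositive_iff_complex]
    intro x
    have hx : inner ℂ ((Q s₀).toEuclideanLin x) x
        = star (Q s₀ *ᵥ WithLp.ofLp x) ⬝ᵥ WithLp.ofLp x := by
      rw [EuclideanSpace.inner_eq_star_dotProduct, dotProduct_comm]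
      rfl
    rw [hx]
    exact ⟨Complex.ext rfl (hk _).1.symm, (hk _).2.1⟩
  refine ⟨?_, hpsd⟩
  -- For `N ≥ 2` the quadratic form of `Q s₀` vanishes; being semidefinite, `Q s₀` then kills every
  -- basis vector.
  by_contra hN1
  refine hQ0 (Matrix.ext_of_mulVec_single fun i => ?_)
  rw [Matrix.zero_mulVec, ← hpsd.dotProduct_mulVec_zero_iff]
  have := (hk (Pi.single i 1)).2.2 (by omega)
  rw [Matrix.star_mulVec, hpsd.1.eq, ← Matrix.dotProduct_mulVec] at this
  exact this

theorem exists_pos_eigenvalue {K : Matrix ι ι ℂ} (hK : K.PosSemidef) (hK0 : K ≠ 0) :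
    ∃ κ : ℝ, 0 < κ ∧ K.charpoly.IsRoot κ := by
  obtain ⟨i, hi⟩ := Function.ne_iff.1 (mt hK.1.eigenvalues_eq_zero_iff.1 hK0)
  refine ⟨hK.1.eigenvalues i, (hK.eigenvalues_nonneg i).lt_of_ne' hi, ?_⟩
  rw [← Matrix.mem_spectrum_iff_isRoot_charpoly]
  have := hK.1.eigenvalues_mem_spectrum_real i
  rw [← spectrum.algebraMap_mem_iff ℂ] at this
  exact this

/-- If `‖M‖ ≤ 1` on the closed right half plane and `1 - M` has an isolated singular point on the
imaginary axis, then for small `ε > 0` the function `1 - (1 + ε) M` is singular at some point of the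
open right half plane. -/
theorem eventually_exists_det_one_sub_smul_eq_zero (hs₀ : s₀.re = 0)
    (hMan : ∀ i j, AnalyticAt ℂ (fun s => M s i j) s₀) (hM : ∀ s : ℂ, 0 ≤ s.re → ‖M s‖ ≤ 1)
    (h0 : (1 - M s₀).det = 0) (hne : ∀ᶠ s in 𝓝[≠] s₀, (1 - M s).det ≠ 0) :
    ∀ᶠ ε in 𝓝[>] (0 : ℝ), ∃ s : ℂ, 0 < s.re ∧ (1 - ((1 + ε : ℝ) : ℂ) • M s).det = 0 := by
  obtain ⟨N, Q, hN, hQan, hQ0, hMQ⟩ := exists_mul_eq_pow_smul_one (M := fun s => 1 - M s)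
    (fun i j => analyticAt_const.sub (hMan i j)) h0 hne
  have hQc : ContinuousAt Q s₀ := continuousAt_matrix fun i j => (hQan i j).continuousAt
  obtain ⟨rfl, hpsd⟩ := posSemidef_residue hs₀ hM hQc hN hQ0 hMQ
  simp only [pow_one] at hMQ
  obtain ⟨κ, hκ, hroot⟩ := exists_pos_eigenvalue hpsd hQ0
  -- `r < κ` keeps the disc in the open right half plane; avoiding the finitely many distances from
  -- `κ` to eigenvalues keeps its boundary free of zeros.
  obtain ⟨r, hr, hrκ, hsph⟩ : ∃ r : ℝ, 0 < r ∧ r < κ ∧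
      ∀ w ∈ Metric.sphere (κ : ℂ) r, ¬ (Q s₀).charpoly.IsRoot w := by
    have hfin : {w | (Q s₀).charpoly.IsRoot w}.Finite :=
      Polynomial.finite_setOfPred_isRoot (Matrix.charpoly_monic _).ne_zero
    obtain ⟨r, ⟨hr, hrκ⟩, hrn⟩ :=
      ((Ioo_infinite hκ).sdiff (hfin.image fun w => dist w (κ : ℂ))).nonempty
    exact ⟨r, hr, hrκ, fun w hw hw' => hrn ⟨w, hw', hw⟩⟩
  let φ : ℝ × ℂ → ℂ := fun p => s₀ + p.1 * p.2
  have hφ : ∀ w : ℂ, Tendsto φ (𝓝 (0, w)) (𝓝 s₀) := fun w => by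
    have : ContinuousAt φ (0, w) := by fun_prop
    simpa [φ] using this.tendsto
  -- Blow-up at `s₀`: in the variable `w = (s - s₀) / δ` the limit `δ → 0` is regular and equals the
  -- characteristic polynomial of `Q s₀`.
  let F : ℝ → ℂ → ℂ := fun δ w => (w • (1 : Matrix ι ι ℂ) - Q (s₀ + δ * w)).det
  have hF0 : ∀ w, F 0 w = (Q s₀).charpoly.eval w := fun w => by
    simp [F, Matrix.eval_charpoly, Matrix.smul_one_eq_diagonal]
  have hcont : ∀ w ∈ Metric.closedBall (κ : ℂ) r,
      ContinuousAt (fun p : ℝ × ℂ => F p.1 p.2) (0, w) := fun w _ => by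
    have hQφ : ContinuousAt (fun p : ℝ × ℂ => Q (s₀ + p.1 * p.2)) (0, w) := by
      have h1 : ContinuousAt Q (φ (0, w)) := by simpa [φ] using hQc
      exact h1.comp (f := φ) (by fun_prop)
    have h2 : ContinuousAt (fun p : ℝ × ℂ => p.2 • (1 : Matrix ι ι ℂ) - Q (s₀ + p.1 * p.2))
        (0, w) := (continuousAt_snd.smul continuousAt_const).sub hQφ
    exact (Continuous.matrix_det continuous_id).continuousAt.comp h2
  have hdiff : ∀ w ∈ Metric.closedBall (κ : ℂ) r,
      ∀ᶠ p : ℝ × ℂ in 𝓝 (0, w), DifferentiableAt ℂ (F p.1) p.2 := fun w _ => by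
    have h1 : ∀ᶠ s in 𝓝 s₀, ∀ i j, AnalyticAt ℂ (fun s => Q s i j) s :=
      eventually_all.2 fun i => eventually_all.2 fun j => (hQan i j).eventually_analyticAt
    filter_upwards [(hφ w).eventually h1] with p hp
    refine (analyticAt_det fun i j => ?_).differentiableAt
    have h2 : AnalyticAt ℂ (fun w : ℂ => s₀ + p.1 * w) p.2 := by fun_prop
    have h3 : AnalyticAt ℂ (fun w : ℂ => Q (s₀ + p.1 * w) i j) p.2 :=
      AnalyticAt.fun_comp (f := fun w : ℂ => s₀ + p.1 * w) (hp i j) h2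
    exact (analyticAt_id.mul analyticAt_const).sub h3
  have hzero := eventually_exists_zero hr hcont hdiff ((hF0 κ).trans hroot)
    fun w hw => by rw [hF0]; exact hsph w hw
  have hMQ' : ∀ᶠ δ : ℝ in 𝓝 0, ∀ w ∈ Metric.closedBall (κ : ℂ) r,
      (1 - M (s₀ + δ * w)) * Q (s₀ + δ * w) = (s₀ + δ * w - s₀) • (1 : Matrix ι ι ℂ) :=
    (isCompact_closedBall _ r).eventually_forall_of_forall_eventually
      fun w _ => (hφ w).eventually hMQ
  have hδ : Tendsto (fun ε : ℝ => ε / (1 + ε)) (𝓝[>] 0) (𝓝 0) := by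
    have : ContinuousAt (fun ε : ℝ => ε / (1 + ε)) 0 :=
      continuousAt_id.div (by fun_prop) (by norm_num)
    simpa using this.tendsto.mono_left nhdsWithin_le_nhds
  filter_upwards [hδ.eventually (hzero.and hMQ'), self_mem_nhdsWithin] with ε hε hε0
  have hε0 : 0 < ε := hε0
  obtain ⟨⟨w, hw, hFw⟩, hall⟩ := hε
  have hMQw := hall w hw
  -- Chosen so that `(1 - δ)(1 + ε) = 1`.
  set δ := ε / (1 + ε) with hδdef
  set s := s₀ + δ * w with hs
  have hwre : 0 < w.re := by
    have h1 : |(w - κ).re| ≤ r := (Complex.abs_re_le_norm _).trans (by simpa [dist_eq_norm] using hw)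
    have h2 := neg_le_of_abs_le h1
    simp only [Complex.sub_re, Complex.ofReal_re] at h2
    linarith
  have hw0 : w ≠ 0 := fun h => by simp [h] at hwre
  refine ⟨s, ?_, ?_⟩
  · rw [hs, Complex.add_re, hs₀, Complex.re_ofReal_mul, zero_add]
    positivity
  -- Since `(1 - M) Q = δ w`, the left side is `w (1 - M) - δ w = w ((1 - δ) - M)`.
  · have h1 : (1 - M s) * (w • (1 : Matrix ι ι ℂ) - Q s)
        = (w * (1 - δ)) • (1 - ((1 + ε : ℝ) : ℂ) • M s) := by
      have h2 : (1 - (δ : ℂ)) * ((1 + ε : ℝ) : ℂ) = 1 := by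
        have : (1 - δ) * (1 + ε) = 1 := by rw [hδdef]; field_simp; ring
        exact_mod_cast this
      rw [Matrix.mul_sub, hMQw, hs, add_sub_cancel_left, ← hs, Matrix.mul_smul, Matrix.mul_one,
        smul_sub (w * (1 - (δ : ℂ))), smul_smul, mul_assoc w, h2]
      module
    have h3 := congrArg Matrix.det h1
    have hF' : (w • (1 : Matrix ι ι ℂ) - Q s).det = 0 := hFw
    rw [Matrix.det_mul, hF', mul_zero, Matrix.det_smul] at h3
    refine (mul_eq_zero.1 h3.symm).resolve_left (pow_ne_zero _ (mul_ne_zero hw0 ?_))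
    have : 1 - δ ≠ 0 := by
      have : 1 - δ = 1 / (1 + ε) := by rw [hδdef]; field_simp; ring
      rw [this]; positivity
    exact_mod_cast this

end PositiveReal

/-! ### The linear feedback loop -/

theorem fromBlocks_sub_fromBlocks {R n m l o : Type*} [AddGroup R] (A A' : Matrix n l R)
    (B B' : Matrix n m R) (C C' : Matrix o l R) (D D' : Matrix o m R) :
    Matrix.fromBlocks A B C D - Matrix.fromBlocks A' B' C' D'
      = Matrix.fromBlocks (A - A') (B - B') (C - C') (D - D') := by
  ext i j
  rcases i with i | i <;> rcases j with j | j <;> rfl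

theorem map_ofReal_inv {ι : Type*} [Fintype ι] [DecidableEq ι] {W : Matrix ι ι ℝ}
    (hW : W.det ≠ 0) : W⁻¹.map Complex.ofReal = (W.map Complex.ofReal)⁻¹ := by
  symm
  refine Matrix.inv_eq_left_inv ?_
  have h := congrArg (fun Y : Matrix ι ι ℝ => Y.map Complex.ofRealHom)
    (Matrix.nonsing_inv_mul W (isUnit_iff_ne_zero.2 hW))
  simp only [Matrix.map_mul, Matrix.map_one _ (map_zero Complex.ofRealHom)
    (map_one Complex.ofRealHom)] at h
  exact h

/-- The return difference determinant of a feedback loop, from two Schur complements of the matrix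
of the loop equations. -/
theorem det_returnDifference {K n m p k : Type*} [Field K] [Fintype n] [DecidableEq n] [Fintype m]
    [DecidableEq m] [Fintype p] [Fintype k] [DecidableEq k]
    (P : Matrix n n K) (B : Matrix n m K) (C : Matrix p n K) (D : Matrix p m K)
    (R : Matrix k k K) (B₁ : Matrix k p K) (C₁ : Matrix m k K) (D₁ : Matrix m p K)
    (hP : P.det ≠ 0) (hR : R.det ≠ 0) (hW : (1 - D₁ * D).det ≠ 0) :
    (1 - D₁ * D).det * (Matrix.fromBlocks (P - B * (1 - D₁ * D)⁻¹ * D₁ * C)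
        (-(B * (1 - D₁ * D)⁻¹ * C₁)) (-(B₁ * (C + D * (1 - D₁ * D)⁻¹ * D₁ * C)))
        (R - B₁ * D * (1 - D₁ * D)⁻¹ * C₁)).det
      = P.det * R.det * (1 - (C₁ * R⁻¹ * B₁ + D₁) * (C * P⁻¹ * B + D)).det := by
  set W := 1 - D₁ * D with hWdef
  have hPu : IsUnit P := (Matrix.isUnit_iff_isUnit_det P).2 (isUnit_iff_ne_zero.2 hP)
  have hRu : IsUnit R := (Matrix.isUnit_iff_isUnit_det R).2 (isUnit_iff_ne_zero.2 hR)
  have hWu : IsUnit W := (Matrix.isUnit_iff_isUnit_det W).2 (isUnit_iff_ne_zero.2 hW)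
  -- The loop equations in `(x, y, w)`, with `r` substituted, have block matrix `[T₁ T₂; T₃ W]`.
  -- Eliminating `w` gives the loop matrix; eliminating `(x, y)` gives the return difference.
  let T₁ : Matrix (n ⊕ k) (n ⊕ k) K := Matrix.fromBlocks P 0 (-(B₁ * C)) R
  let T₂ : Matrix (n ⊕ k) m K := Matrix.fromRows (-B) (-(B₁ * D))
  let T₃ : Matrix m (n ⊕ k) K := Matrix.fromCols (-(D₁ * C)) (-C₁)
  have hT₁ : T₁.det = P.det * R.det := Matrix.det_fromBlocks_zero₁₂ _ _ _
  have hTu : IsUnit T₁ := (Matrix.isUnit_iff_isUnit_det T₁).2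
    (isUnit_iff_ne_zero.2 (hT₁ ▸ mul_ne_zero hP hR))
  have := hTu.invertible
  have := hWu.invertible
  have h1 := Matrix.det_fromBlocks₁₁ T₁ T₂ T₃ W
  have h2 := Matrix.det_fromBlocks₂₂ T₁ T₂ T₃ W
  rw [Matrix.invOf_eq_nonsing_inv] at h1 h2
  have e1 : T₁ - T₂ * W⁻¹ * T₃ = Matrix.fromBlocks (P - B * W⁻¹ * D₁ * C) (-(B * W⁻¹ * C₁))
      (-(B₁ * (C + D * W⁻¹ * D₁ * C))) (R - B₁ * D * W⁻¹ * C₁) := by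
    rw [Matrix.fromRows_mul, Matrix.fromRows_mul_fromCols, fromBlocks_sub_fromBlocks]
    congr 1 <;> simp only [Matrix.neg_mul, Matrix.mul_neg, neg_neg, Matrix.mul_add,
      Matrix.mul_assoc, zero_sub]
    all_goals abel
  have e2 : W - T₃ * T₁⁻¹ * T₂ = 1 - (C₁ * R⁻¹ * B₁ + D₁) * (C * P⁻¹ * B + D) := by
    have hinv : T₁⁻¹ = Matrix.fromBlocks P⁻¹ 0 (-(R⁻¹ * (-(B₁ * C)) * P⁻¹)) R⁻¹ :=
      Matrix.inv_fromBlocks_zero₁₂_of_isUnit_iff _ _ _ ⟨fun _ => hRu, fun _ => hPu⟩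
    rw [hinv]
    simp only [T₂, T₃, Matrix.fromCols_mul_fromBlocks, Matrix.fromCols_mul_fromRows, hWdef]
    simp only [Matrix.neg_mul, Matrix.mul_neg, neg_neg, Matrix.mul_zero, zero_add, Matrix.mul_add,
      Matrix.add_mul, Matrix.mul_assoc]
    abel
  rw [← e1, ← h2, h1, e2, hT₁]

section LinearLoop

variable {n m p k : ℕ}

/-- The resolvent matrix of a stable system is invertible on the closed right half plane. -/
theorem LTI.IsStable.det_ne_zero {G : LTI n m p} (hG : G.IsStable) {s : ℂ} (hs : 0 ≤ s.re) :
    (s • (1 : Matrix (Fin n) (Fin n) ℂ) - G.A.map Complex.ofReal).det ≠ 0 := fun h => by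
  refine absurd (hG s ?_) (not_lt.2 hs)
  rw [Matrix.mem_spectrum_iff_isRoot_charpoly, Polynomial.IsRoot, Matrix.eval_charpoly]
  rwa [Matrix.smul_one_eq_diagonal] at h

theorem analyticAt_transfer (G : LTI n m p) {s₀ : ℂ}
    (hs : (s₀ • (1 : Matrix (Fin n) (Fin n) ℂ) - G.A.map Complex.ofReal).det ≠ 0) (i : Fin p)
    (j : Fin m) : AnalyticAt ℂ (fun s => G.transfer s i j) s₀ := by
  have hP : ∀ i j, AnalyticAt ℂ
      (fun s => (s • (1 : Matrix (Fin n) (Fin n) ℂ) - G.A.map Complex.ofReal) i j) s₀ :=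
    fun i j => (analyticAt_id.mul analyticAt_const).sub analyticAt_const
  have hinv : ∀ i j, AnalyticAt ℂ
      (fun s => (s • (1 : Matrix (Fin n) (Fin n) ℂ) - G.A.map Complex.ofReal)⁻¹ i j) s₀ := by
    intro i j
    simp only [Matrix.inv_def, Ring.inverse_eq_inv', Matrix.smul_apply, smul_eq_mul]
    exact ((analyticAt_det hP).inv hs).mul (analyticAt_adjugate hP i j)
  simp only [LTI.transfer, Matrix.add_apply, Matrix.mul_apply]
  exact (Finset.analyticAt_fun_sum _ fun a _ => (Finset.analyticAt_fun_sum _ fun b _ =>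
    analyticAt_const.mul (hinv b a)).mul analyticAt_const).add analyticAt_const

theorem LTI.transfer_scale (Δ : LTI k p m) (c : ℝ) (s : ℂ) :
    (Δ.scale c).transfer s = (c : ℂ) • Δ.transfer s := by
  have hC : (c • Δ.C).map Complex.ofReal = (c : ℂ) • Δ.C.map Complex.ofReal := by
    ext; simp
  have hD : (c • Δ.D).map Complex.ofReal = (c : ℂ) • Δ.D.map Complex.ofReal := by
    ext; simp
  simp only [LTI.transfer, LTI.scale, hC, hD, Matrix.smul_mul, smul_add]

/-- The eigenvalues of the loop matrix are governed by the return difference `1 - Δ(s) G(s)`. -/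
theorem det_mul_eval_charpoly_loopMatrix (G : LTI n m p) (Δ : LTI k p m)
    (hwp : G.LoopWellPosed Δ) {s : ℂ}
    (hG : (s • (1 : Matrix (Fin n) (Fin n) ℂ) - G.A.map Complex.ofReal).det ≠ 0)
    (hΔ : (s • (1 : Matrix (Fin k) (Fin k) ℂ) - Δ.A.map Complex.ofReal).det ≠ 0) :
    ((1 - Δ.D * G.D).det : ℂ) * ((G.loopMatrix Δ).map Complex.ofReal).charpoly.eval s
      = (s • (1 : Matrix (Fin n) (Fin n) ℂ) - G.A.map Complex.ofReal).det
        * (s • (1 : Matrix (Fin k) (Fin k) ℂ) - Δ.A.map Complex.ofReal).det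
        * (1 - Δ.transfer s * G.transfer s).det := by
  have hmul : ∀ {a b c : ℕ} (X : Matrix (Fin a) (Fin b) ℝ) (Y : Matrix (Fin b) (Fin c) ℝ),
      (X * Y).map Complex.ofReal = X.map Complex.ofReal * Y.map Complex.ofReal :=
    fun X Y => Matrix.map_mul (f := Complex.ofRealHom)
  have hadd : ∀ {a b : ℕ} (X Y : Matrix (Fin a) (Fin b) ℝ),
      (X + Y).map Complex.ofReal = X.map Complex.ofReal + Y.map Complex.ofReal :=
    fun X Y => Matrix.map_add _ Complex.ofReal_add X Y
  have hW : (1 - Δ.D * G.D).map Complex.ofReal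
      = 1 - Δ.D.map Complex.ofReal * G.D.map Complex.ofReal := by
    rw [Matrix.map_sub _ Complex.ofReal_sub, hmul,
      Matrix.map_one _ Complex.ofReal_zero Complex.ofReal_one]
  have hWdet : ((1 - Δ.D * G.D).det : ℂ)
      = (1 - Δ.D.map Complex.ofReal * G.D.map Complex.ofReal).det := by
    rw [← hW]
    exact RingHom.map_det Complex.ofRealHom _
  have hWne : (1 - Δ.D.map Complex.ofReal * G.D.map Complex.ofReal).det ≠ 0 := by
    rw [← hWdet]
    exact_mod_cast hwp
  rw [hWdet]
  refine Eq.trans ?_ (det_returnDifference _ _ _ _ _ _ _ _ hG hΔ hWne)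
  congr 1
  rw [Matrix.eval_charpoly, ← hW, ← map_ofReal_inv hwp]
  congr 1
  rw [Matrix.scalar_apply, ← Matrix.smul_one_eq_diagonal, LTI.loopMatrix, Matrix.fromBlocks_map,
    ← Matrix.fromBlocks_one, Matrix.fromBlocks_smul, fromBlocks_sub_fromBlocks]
  simp only [hmul, hadd, smul_zero, zero_sub, sub_sub, Matrix.mul_assoc]

/-- Submultiplicativity of the spectral norm. In `ℝ≥0∞` the bound `a⁻¹ * a ≤ 1` also holds for `a =
0` and `a = ∞`, so no case distinction on the norm of `G` is needed. -/
theorem norm_transfer_mul_transfer_le_one {G : LTI n m p} {Δ : LTI k p m}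
    (hΔ : Δ.hinfNorm = 1 / G.hinfNorm) {s : ℂ} (hs : 0 ≤ s.re) :
    ‖Δ.transfer s * G.transfer s‖ ≤ 1 := by
  have h1 : ‖Δ.transfer s‖ₑ ≤ Δ.hinfNorm :=
    le_iSup (fun s : {s : ℂ // 0 ≤ s.re} => ‖Δ.transfer s‖ₑ) ⟨s, hs⟩
  have h2 : ‖G.transfer s‖ₑ ≤ G.hinfNorm :=
    le_iSup (fun s : {s : ℂ // 0 ≤ s.re} => ‖G.transfer s‖ₑ) ⟨s, hs⟩
  have h3 : ‖Δ.transfer s‖ₑ * ‖G.transfer s‖ₑ ≤ 1 := by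
    refine (mul_le_mul' h1 h2).trans ?_
    rw [hΔ, one_div]
    exact ENNReal.inv_mul_le_one _
  refine (Matrix.l2_opNorm_mul _ _).trans ?_
  rw [← ofReal_norm, ← ofReal_norm, ← ENNReal.ofReal_mul (norm_nonneg _)] at h3
  exact ENNReal.ofReal_le_one.1 h3

theorem eventually_nhdsNE_eval_charpoly_ne_zero {ι : Type*} [Fintype ι] [DecidableEq ι]
    (A : Matrix ι ι ℂ) (s₀ : ℂ) : ∀ᶠ s in 𝓝[≠] s₀, A.charpoly.eval s ≠ 0 := by
  have hfin : {w | A.charpoly.IsRoot w}.Finite :=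
    Polynomial.finite_setOfPred_isRoot (Matrix.charpoly_monic _).ne_zero
  exact nhdsNE_le_cofinite s₀ hfin.compl_mem_cofinite

theorem eventually_loopWellPosed_scale {G : LTI n m p} {Δ : LTI k p m} (hwp : G.LoopWellPosed Δ) :
    ∀ᶠ ε in 𝓝[>] (0 : ℝ), G.LoopWellPosed (Δ.scale (1 + ε)) := by
  have hc : Continuous fun ε : ℝ => (1 - ((1 + ε) • Δ.D) * G.D).det :=
    Continuous.matrix_det (by fun_prop)
  refine (hc.continuousAt.eventually_ne ?_).filter_mono nhdsWithin_le_nhds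
  rw [add_zero, one_smul]
  exact hwp

/-- After an arbitrarily small increase of its gain, a minimal destabilizing attack moves an
eigenvalue of the loop into the open right half plane. -/
theorem IsMinimalDestabilizingAttack.eventually_exists_unstable_eigenvalue {G : LTI n m p}
    {Δ : LTI k p m} (hG : G.IsStable) (hΔ : IsMinimalDestabilizingAttack G Δ)
    (hwp : G.LoopWellPosed Δ) :
    ∀ᶠ ε in 𝓝[>] (0 : ℝ), G.LoopWellPosed (Δ.scale (1 + ε)) ∧
      ∃ μ ∈ spectrum ℂ ((G.loopMatrix (Δ.scale (1 + ε))).map Complex.ofReal), 0 < μ.re := by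
  obtain ⟨ω, hω⟩ := hΔ.destabilizing
  set s₀ : ℂ := ω * Complex.I with hs₀
  have hre : s₀.re = 0 := by simp [hs₀]
  have hchar : ∀ {a : ℕ} (A : Matrix (Fin a) (Fin a) ℂ), ∀ᶠ s in 𝓝[≠] s₀,
      (s • (1 : Matrix (Fin a) (Fin a) ℂ) - A).det ≠ 0 := fun A => by
    refine (eventually_nhdsNE_eval_charpoly_ne_zero A s₀).mono fun s hs => ?_
    rwa [Matrix.eval_charpoly, Matrix.scalar_apply, ← Matrix.smul_one_eq_diagonal] at hs
  -- Well-posedness enters here: a zero of the return difference off the poles is an eigenvalue of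
  -- the loop matrix, and there are finitely many.
  have hne : ∀ᶠ s in 𝓝[≠] s₀, (1 - Δ.transfer s * G.transfer s).det ≠ 0 := by
    filter_upwards [eventually_nhdsNE_eval_charpoly_ne_zero
      ((G.loopMatrix Δ).map Complex.ofReal) s₀, hchar (G.A.map Complex.ofReal),
      hchar (Δ.A.map Complex.ofReal)] with s h1 h2 h3 h4
    have := det_mul_eval_charpoly_loopMatrix G Δ hwp h2 h3
    rw [h4, mul_zero] at this
    exact mul_ne_zero (Complex.ofReal_ne_zero.2 hwp) h1 this
  have han : ∀ i j, AnalyticAt ℂ (fun s => (Δ.transfer s * G.transfer s) i j) s₀ := fun i j => by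
    simp only [Matrix.mul_apply]
    exact Finset.analyticAt_fun_sum _ fun a _ =>
      (analyticAt_transfer Δ (hΔ.stable.det_ne_zero hre.ge) _ _).mul
        (analyticAt_transfer G (hG.det_ne_zero hre.ge) _ _)
  filter_upwards [eventually_loopWellPosed_scale hwp,
    eventually_exists_det_one_sub_smul_eq_zero hre han
      (fun s hs => norm_transfer_mul_transfer_le_one hΔ.minimal hs) hω hne] with ε hε hs
  obtain ⟨s, hsre, hs⟩ := hs
  refine ⟨hε, s, ?_, hsre⟩
  have h := det_mul_eval_charpoly_loopMatrix G (Δ.scale (1 + ε)) hε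
    (hG.det_ne_zero hsre.le) (hΔ.stable.det_ne_zero hsre.le)
  rw [LTI.transfer_scale, Matrix.smul_mul, hs, mul_zero] at h
  exact Matrix.mem_spectrum_iff_isRoot_charpoly.2
    ((mul_eq_zero.1 h).resolve_left (Complex.ofReal_ne_zero.2 hε))

theorem loopInternallyUnstable_of_mem_spectrum {G : LTI n m p} {Δ : LTI k p m} {μ : ℂ}
    (hμ : μ ∈ spectrum ℂ ((G.loopMatrix Δ).map Complex.ofReal)) (hre : 0 < μ.re) :
    G.LoopInternallyUnstable Δ := by
  refine ⟨⟨μ, hμ, hre⟩, Matrix.mulVec_zero _, ?_⟩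
  let L : (Fin n ⊕ Fin k → ℝ) →L[ℝ] (Fin n ⊕ Fin k → ℝ) :=
    LinearMap.toContinuousLinearMap (Matrix.mulVecLin (G.loopMatrix Δ))
  have hL : (fun z : Fin n ⊕ Fin k → ℝ => G.loopMatrix Δ *ᵥ z) = L := rfl
  rw [hL]
  refine not_lyapunovStable_of_mem_spectrum L.contDiff.contDiffAt (map_zero L)
    (ContinuousLinearEquiv.refl ℝ _) (M := G.loopMatrix Δ) (fun x => ?_) hμ hre
  rw [L.fderiv]
  rfl

end LinearLoop

/-! ### The nonlinear feedback loop -/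

theorem jacobian_mulVec {a b : ℕ} (φ : (Fin a → ℝ) → (Fin b → ℝ)) (x v : Fin a → ℝ) :
    jacobian φ x *ᵥ v = fderiv ℝ φ x v :=
  LinearMap.toMatrix'_mulVec _ _

theorem fderiv_zero_apply_eq_jacobian {a b c : ℕ}
    {φ : (Fin a → ℝ) → (Fin b → ℝ) → (Fin c → ℝ)}
    (h : DifferentiableAt ℝ (fun z : (Fin a → ℝ) × (Fin b → ℝ) => φ z.1 z.2) 0)
    (v : Fin a → ℝ) (w : Fin b → ℝ) :
    fderiv ℝ (fun z : (Fin a → ℝ) × (Fin b → ℝ) => φ z.1 z.2) 0 (v, w)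
      = jacobian (fun x => φ x 0) 0 *ᵥ v + jacobian (fun u => φ 0 u) 0 *ᵥ w := by
  have h1 : HasFDerivAt (fun x => φ x 0) _ 0 :=
    HasFDerivAt.comp (0 : Fin a → ℝ) (f := fun x : Fin a → ℝ => (x, (0 : Fin b → ℝ)))
      h.hasFDerivAt (hasFDerivAt_prodMk_left 0 0)
  have h2 : HasFDerivAt (fun u => φ 0 u) _ 0 :=
    HasFDerivAt.comp (0 : Fin b → ℝ) (f := fun u : Fin b → ℝ => ((0 : Fin a → ℝ), u))
      h.hasFDerivAt (hasFDerivAt_prodMk_right 0 0)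
  rw [jacobian_mulVec, jacobian_mulVec, h1.fderiv, h2.fderiv]
  simp only [ContinuousLinearMap.comp_apply, ContinuousLinearMap.inl_apply,
    ContinuousLinearMap.inr_apply, ← map_add, Prod.mk_add_mk, add_zero, zero_add]

section NonlinearLoop

variable {n m p k : ℕ} {S : ExposedSystem n m p} {Δ : LTI k p m}

/-- The gap `1 - q` is uniform in `(x, w)`, so a single small gain increase respects it everywhere.
-/
theorem ExposedSystem.RobustlyWellConnected.eventually_scale (h : S.RobustlyWellConnected Δ) :
    ∀ᶠ ε in 𝓝[>] (0 : ℝ), S.RobustlyWellConnected (Δ.scale (1 + ε)) := by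
  rcases h with h | ⟨q, hq, h⟩
  · refine Eventually.of_forall fun ε => Or.inl ?_
    simp [LTI.scale, h]
  · have hc : Continuous fun ε : ℝ => (1 + ε) * q := by fun_prop
    have h1 : ∀ᶠ ε in 𝓝[>] (0 : ℝ), (1 + ε) * q < 1 :=
      (hc.continuousAt.eventually (gt_mem_nhds (by simpa using hq))).filter_mono nhdsWithin_le_nhds
    filter_upwards [h1, self_mem_nhdsWithin] with ε hε hε0
    have hε0 : 0 < ε := hε0
    refine Or.inr ⟨(1 + ε) * q, hε, fun x w => ⟨(h x w).1, ?_⟩⟩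
    simp only [LTI.scale]
    rw [Matrix.smul_mul, norm_smul, Real.norm_of_nonneg (by positivity)]
    exact mul_le_mul_of_nonneg_left (h x w).2 (by positivity)

theorem ExposedSystem.RobustlyWellConnected.det_ne_zero (h : S.RobustlyWellConnected Δ)
    (x : Fin n → ℝ) (w : Fin m → ℝ) : (1 - Δ.D * jacobian (S.g x) w).det ≠ 0 := by
  rcases h with h | ⟨q, hq, h⟩
  · simp [h]
  · have : CompleteSpace (Matrix (Fin m) (Fin m) ℝ) := FiniteDimensional.complete ℝ _
    have hu := isUnit_one_sub_of_norm_lt_one ((h x w).2.trans_lt hq)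
    exact ((Matrix.isUnit_iff_isUnit_det _).1 hu).ne_zero

/-- The algebraic loop equation has a unique solution, by the contraction principle. -/
theorem ExposedSystem.RobustlyWellConnected.existsUnique_isLoopInput
    (h : S.RobustlyWellConnected Δ) (z : (Fin n → ℝ) × (Fin k → ℝ)) :
    ∃! w, S.IsLoopInput Δ z w := by
  rcases h with h | ⟨q, hq, h⟩
  · refine ⟨Δ.C *ᵥ z.2, ?_, fun w hw => ?_⟩
    · simp [ExposedSystem.IsLoopInput, h]
    · simpa [ExposedSystem.IsLoopInput, h] using hw
  · lift q to NNReal using (norm_nonneg _).trans (h 0 0).2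
    -- The hypothesis bounds the spectral norm, so the map is a contraction for the Euclidean norm
    -- and not necessarily for the sup norm of `Fin m → ℝ`.
    let Φ : EuclideanSpace ℝ (Fin m) → EuclideanSpace ℝ (Fin m) := fun w =>
      WithLp.toLp 2 (Δ.C *ᵥ z.2 + Δ.D *ᵥ S.g z.1 (WithLp.ofLp w))
    let e : EuclideanSpace ℝ (Fin m) ≃L[ℝ] (Fin m → ℝ) := EuclideanSpace.equiv (Fin m) ℝ
    let DL : (Fin p → ℝ) →L[ℝ] (Fin m → ℝ) :=
      LinearMap.toContinuousLinearMap (Matrix.mulVecLin Δ.D)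
    have hΦ : ∀ w, HasFDerivAt Φ ((e.symm : (Fin m → ℝ) →L[ℝ] EuclideanSpace ℝ (Fin m)) ∘L
        (DL ∘L (fderiv ℝ (S.g z.1) (e w) ∘L
          (e : EuclideanSpace ℝ (Fin m) →L[ℝ] (Fin m → ℝ))))) w := fun w =>
      e.symm.hasFDerivAt.comp w
        ((DL.hasFDerivAt.comp w ((h z.1 (e w)).1.hasFDerivAt.comp w e.hasFDerivAt)).const_add
          (Δ.C *ᵥ z.2))
    have hlip : LipschitzWith q Φ := by
      refine lipschitzWith_of_nnnorm_fderiv_le (𝕜 := ℝ) (fun w => (hΦ w).differentiableAt)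
        fun w => ?_
      rw [(hΦ w).fderiv, ← NNReal.coe_le_coe, coe_nnnorm]
      refine ContinuousLinearMap.opNorm_le_bound _ q.coe_nonneg fun v => ?_
      have h1 := Matrix.l2_opNorm_mulVec (Δ.D * jacobian (S.g z.1) (e w)) v
      rw [← Matrix.mulVec_mulVec, jacobian_mulVec] at h1
      exact h1.trans (mul_le_mul_of_nonneg_right (h _ _).2 (norm_nonneg _))
    have hcon : ContractingWith q Φ := ⟨by exact_mod_cast hq, hlip⟩
    refine ⟨WithLp.ofLp (hcon.fixedPoint Φ), ?_, fun w hw => ?_⟩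
    · exact (congrArg WithLp.ofLp hcon.fixedPoint_isFixedPt).symm
    · have : Function.IsFixedPt Φ (WithLp.toLp 2 w) := congrArg (WithLp.toLp 2) hw.symm
      exact congrArg WithLp.ofLp (hcon.fixedPoint_unique this)

theorem ExposedSystem.RobustlyWellConnected.isLoopInput_loopInput
    (h : S.RobustlyWellConnected Δ) (z : (Fin n → ℝ) × (Fin k → ℝ)) :
    S.IsLoopInput Δ z (S.loopInput Δ z) :=
  Classical.epsilon_spec (h.existsUnique_isLoopInput z).exists

theorem ExposedSystem.RobustlyWellConnected.loopInput_zero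
    (h : S.RobustlyWellConnected Δ) (hS : S.IsRegular) : S.loopInput Δ 0 = 0 :=
  (h.existsUnique_isLoopInput 0).unique (h.isLoopInput_loopInput 0)
    (by simp [ExposedSystem.IsLoopInput, hS.g_zero])

/-- Implicit function theorem for `w - C₁ y - D₁ g(x, w) = 0` at the origin, where the partial
derivative in `w` is the invertible matrix `1 - D₁ ∂g/∂w`. -/
theorem ExposedSystem.RobustlyWellConnected.contDiffAt_loopInput
    (h : S.RobustlyWellConnected Δ) (hS : S.IsRegular) : ContDiffAt ℝ 1 (S.loopInput Δ) 0 := by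
  let DL : (Fin p → ℝ) →L[ℝ] (Fin m → ℝ) :=
    LinearMap.toContinuousLinearMap (Matrix.mulVecLin Δ.D)
  let CL : (Fin k → ℝ) →L[ℝ] (Fin m → ℝ) :=
    LinearMap.toContinuousLinearMap (Matrix.mulVecLin Δ.C)
  let H : ((Fin n → ℝ) × (Fin k → ℝ)) × (Fin m → ℝ) → (Fin m → ℝ) :=
    fun u => u.2 - (CL u.1.2 + DL (S.g u.1.1 u.2))
  let π : ((Fin n → ℝ) × (Fin k → ℝ)) × (Fin m → ℝ) →L[ℝ] (Fin n → ℝ) × (Fin m → ℝ) :=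
    ((ContinuousLinearMap.fst ℝ _ _).comp (ContinuousLinearMap.fst ℝ _ _)).prod
      (ContinuousLinearMap.snd ℝ _ _)
  have hg : ContDiffAt ℝ 1 (fun u : ((Fin n → ℝ) × (Fin k → ℝ)) × (Fin m → ℝ) =>
      S.g u.1.1 u.2) (0, 0) :=
    ContDiffAt.comp (f := π) (0, 0) hS.g_smooth π.contDiff.contDiffAt
  have hH : ContDiffAt ℝ 1 H (0, 0) :=
    contDiffAt_snd.sub ((CL.contDiff.contDiffAt.comp _
      (contDiffAt_snd.comp _ contDiffAt_fst)).add (DL.contDiff.contDiffAt.comp _ hg))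
  have hH0 : H (0, 0) = 0 := by simp [H, hS.g_zero]
  set N := 1 - Δ.D * jacobian (S.g 0) 0 with hN
  have hNu : IsUnit N.det := isUnit_iff_ne_zero.2 (h.det_ne_zero 0 0)
  have hpart : ∀ v, (fderiv ℝ H (0, 0) ∘L .inr ℝ _ _) v = N *ᵥ v := by
    have h1 : HasFDerivAt (fun w => H (0, w)) (fderiv ℝ H (0, 0) ∘L .inr ℝ _ _) 0 :=
      HasFDerivAt.comp (0 : Fin m → ℝ) (f := fun w => ((0 : (Fin n → ℝ) × (Fin k → ℝ)), w))
        (hH.differentiableAt one_ne_zero).hasFDerivAt (hasFDerivAt_prodMk_right 0 0)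
    have hg0 : DifferentiableAt ℝ (S.g 0) 0 :=
      DifferentiableAt.comp (0 : Fin m → ℝ) (f := fun w => ((0 : Fin n → ℝ), w))
        (hS.g_smooth.differentiableAt one_ne_zero) (hasFDerivAt_prodMk_right 0 0).differentiableAt
    have h2 : HasFDerivAt (fun w => H (0, w)) (.id ℝ _ - DL ∘L fderiv ℝ (S.g 0) 0) 0 :=
      (hasFDerivAt_id _).sub ((DL.hasFDerivAt.comp 0 hg0.hasFDerivAt).const_add (CL 0))
    intro v
    rw [h1.unique h2, hN, Matrix.sub_mulVec, Matrix.one_mulVec, ← Matrix.mulVec_mulVec,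
      jacobian_mulVec]
    rfl
  have hinv : (fderiv ℝ H (0, 0) ∘L .inr ℝ ((Fin n → ℝ) × (Fin k → ℝ)) _).IsInvertible := by
    refine .of_inverse (g := LinearMap.toContinuousLinearMap (Matrix.mulVecLin N⁻¹)) ?_ ?_
    · ext1 v
      refine (hpart _).trans ?_
      simp [Matrix.mul_nonsing_inv _ hNu]
    · ext1 v
      refine (congrArg (N⁻¹ *ᵥ ·) (hpart v)).trans ?_
      simp [Matrix.nonsing_inv_mul _ hNu]
  -- The loop input is picked by choice; global uniqueness identifies it with the smooth local
  -- branch.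
  refine (hH.contDiffAt_implicitFunction one_ne_zero hinv).congr_of_eventuallyEq ?_
  filter_upwards [hH.eventually_apply_implicitFunction one_ne_zero hinv] with z hz
  rw [hH0] at hz
  exact (h.existsUnique_isLoopInput z).unique (h.isLoopInput_loopInput z) (sub_eq_zero.1 hz)

theorem ExposedSystem.RobustlyWellConnected.contDiffAt_prodMk_loopInput
    (h : S.RobustlyWellConnected Δ) (hS : S.IsRegular) :
    ContDiffAt ℝ 1 (fun z : (Fin n → ℝ) × (Fin k → ℝ) => (z.1, S.loopInput Δ z)) 0 :=
  contDiffAt_fst.prodMk (h.contDiffAt_loopInput hS)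

theorem ExposedSystem.RobustlyWellConnected.hasFDerivAt_comp_loopInput
    (h : S.RobustlyWellConnected Δ) (hS : S.IsRegular) {c : ℕ}
    {φ : (Fin n → ℝ) → (Fin m → ℝ) → (Fin c → ℝ)}
    (hφ : ContDiffAt ℝ 1 (fun z : (Fin n → ℝ) × (Fin m → ℝ) => φ z.1 z.2) 0) :
    HasFDerivAt (fun z : (Fin n → ℝ) × (Fin k → ℝ) => φ z.1 (S.loopInput Δ z))
      (fderiv ℝ (fun z : (Fin n → ℝ) × (Fin m → ℝ) => φ z.1 z.2) 0 ∘L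
        (ContinuousLinearMap.fst ℝ _ _).prod (fderiv ℝ (S.loopInput Δ) 0)) 0 := by
  have h1 : HasFDerivAt (fun z : (Fin n → ℝ) × (Fin k → ℝ) => (z.1, S.loopInput Δ z)) _ 0 :=
    hasFDerivAt_fst.prodMk
      ((h.contDiffAt_loopInput hS).differentiableAt one_ne_zero).hasFDerivAt
  refine HasFDerivAt.comp (0 : (Fin n → ℝ) × (Fin k → ℝ))
    (g := fun z : (Fin n → ℝ) × (Fin m → ℝ) => φ z.1 z.2) ?_ h1
  rw [h.loopInput_zero hS]
  exact (hφ.differentiableAt one_ne_zero).hasFDerivAt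

theorem ExposedSystem.RobustlyWellConnected.contDiffAt_comp_loopInput
    (h : S.RobustlyWellConnected Δ) (hS : S.IsRegular) {c : ℕ}
    {φ : (Fin n → ℝ) → (Fin m → ℝ) → (Fin c → ℝ)}
    (hφ : ContDiffAt ℝ 1 (fun z : (Fin n → ℝ) × (Fin m → ℝ) => φ z.1 z.2) 0) :
    ContDiffAt ℝ 1 (fun z : (Fin n → ℝ) × (Fin k → ℝ) => φ z.1 (S.loopInput Δ z)) 0 := by
  refine ContDiffAt.comp (0 : (Fin n → ℝ) × (Fin k → ℝ))
    (g := fun z : (Fin n → ℝ) × (Fin m → ℝ) => φ z.1 z.2) ?_ (h.contDiffAt_prodMk_loopInput hS)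
  rw [h.loopInput_zero hS]
  exact hφ

theorem ExposedSystem.RobustlyWellConnected.loopWellPosed
    (h : S.RobustlyWellConnected Δ) (hS : S.IsRegular) : S.LoopWellPosed Δ where
  jacobian_invertible := h.det_ne_zero
  existsUnique_input := h.existsUnique_isLoopInput
  contDiffAt_field := by
    let BL := LinearMap.toContinuousLinearMap (Matrix.mulVecLin Δ.B)
    let AL := LinearMap.toContinuousLinearMap (Matrix.mulVecLin Δ.A)
    exact (h.contDiffAt_comp_loopInput hS hS.f_smooth).prodMk
      ((AL.contDiff.contDiffAt.comp _ contDiffAt_snd).add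
        (BL.contDiff.contDiffAt.comp _ (h.contDiffAt_comp_loopInput hS hS.g_smooth)))

/-- The derivative of the loop input at the origin. -/
theorem ExposedSystem.RobustlyWellConnected.fderiv_loopInput_zero
    (h : S.RobustlyWellConnected Δ) (hS : S.IsRegular) (z : (Fin n → ℝ) × (Fin k → ℝ)) :
    fderiv ℝ (S.loopInput Δ) 0 z = (1 - Δ.D * S.linearization.D)⁻¹ *ᵥ
      (Δ.C *ᵥ z.2 + Δ.D *ᵥ (S.linearization.C *ᵥ z.1)) := by
  let DL : (Fin p → ℝ) →L[ℝ] (Fin m → ℝ) :=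
    LinearMap.toContinuousLinearMap (Matrix.mulVecLin Δ.D)
  let CL : (Fin k → ℝ) →L[ℝ] (Fin m → ℝ) :=
    LinearMap.toContinuousLinearMap (Matrix.mulVecLin Δ.C)
  -- Differentiate the loop equation itself: the derivative of the loop input appears on both sides,
  -- and the resulting linear equation is solved for it.
  have h1 : HasFDerivAt (S.loopInput Δ) _ 0 :=
    ((CL.hasFDerivAt.comp 0 hasFDerivAt_snd).add (DL.hasFDerivAt.comp 0
      (h.hasFDerivAt_comp_loopInput hS hS.g_smooth))).congr_of_eventuallyEq
        (Eventually.of_forall h.isLoopInput_loopInput)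
  have h2 : fderiv ℝ (S.loopInput Δ) 0 z = Δ.C *ᵥ z.2 + Δ.D *ᵥ (S.linearization.C *ᵥ z.1
      + S.linearization.D *ᵥ fderiv ℝ (S.loopInput Δ) 0 z) := by
    refine (congrArg (fun L : (Fin n → ℝ) × (Fin k → ℝ) →L[ℝ] (Fin m → ℝ) => L z)
      h1.fderiv).trans ?_
    refine congrArg (fun v => Δ.C *ᵥ z.2 + Δ.D *ᵥ v) ?_
    exact fderiv_zero_apply_eq_jacobian (hS.g_smooth.differentiableAt one_ne_zero) _ _
  have h3 : (1 - Δ.D * S.linearization.D) *ᵥ fderiv ℝ (S.loopInput Δ) 0 z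
      = Δ.C *ᵥ z.2 + Δ.D *ᵥ (S.linearization.C *ᵥ z.1) := by
    rw [Matrix.sub_mulVec, Matrix.one_mulVec, ← Matrix.mulVec_mulVec, sub_eq_iff_eq_add, add_assoc,
      ← Matrix.mulVec_add]
    exact h2
  have hu : IsUnit (1 - Δ.D * S.linearization.D).det := isUnit_iff_ne_zero.2 (h.det_ne_zero 0 0)
  rw [← h3, Matrix.mulVec_mulVec, Matrix.nonsing_inv_mul _ hu, Matrix.one_mulVec]

/-- The linearization of the nonlinear loop is the linear loop of the linearization. -/
theorem ExposedSystem.RobustlyWellConnected.fderiv_loopField_zero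
    (h : S.RobustlyWellConnected Δ) (hS : S.IsRegular) (z : (Fin n → ℝ) × (Fin k → ℝ)) :
    Sum.elim (fderiv ℝ (S.loopField Δ) 0 z).1 (fderiv ℝ (S.loopField Δ) 0 z).2
      = S.linearization.loopMatrix Δ *ᵥ Sum.elim z.1 z.2 := by
  let BL := LinearMap.toContinuousLinearMap (Matrix.mulVecLin Δ.B)
  let AL := LinearMap.toContinuousLinearMap (Matrix.mulVecLin Δ.A)
  have h1 : HasFDerivAt (S.loopField Δ) _ 0 :=
    (h.hasFDerivAt_comp_loopInput hS hS.f_smooth).prodMk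
      ((AL.hasFDerivAt.comp 0 hasFDerivAt_snd).add
        (BL.hasFDerivAt.comp 0 (h.hasFDerivAt_comp_loopInput hS hS.g_smooth)))
  have hfst : (fderiv ℝ (S.loopField Δ) 0 z).1 = S.linearization.A *ᵥ z.1
      + S.linearization.B *ᵥ fderiv ℝ (S.loopInput Δ) 0 z := by
    rw [h1.fderiv]
    exact fderiv_zero_apply_eq_jacobian (hS.f_smooth.differentiableAt one_ne_zero) _ _
  have hsnd : (fderiv ℝ (S.loopField Δ) 0 z).2 = Δ.A *ᵥ z.2
      + Δ.B *ᵥ (S.linearization.C *ᵥ z.1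
        + S.linearization.D *ᵥ fderiv ℝ (S.loopInput Δ) 0 z) := by
    rw [h1.fderiv]
    refine congrArg (fun v => Δ.A *ᵥ z.2 + Δ.B *ᵥ v) ?_
    exact fderiv_zero_apply_eq_jacobian (hS.g_smooth.differentiableAt one_ne_zero) _ _
  rw [hfst, hsnd, h.fderiv_loopInput_zero hS, LTI.loopMatrix, Matrix.fromBlocks_mulVec]
  simp only [Sum.elim_comp_inl, Sum.elim_comp_inr, Matrix.add_mulVec, Matrix.mulVec_add,
    Matrix.mulVec_mulVec, Matrix.mul_add, Matrix.mul_assoc]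
  congr 1 <;> abel

theorem ExposedSystem.RobustlyWellConnected.isUnstableEquilibrium
    (h : S.RobustlyWellConnected Δ) (hS : S.IsRegular) {μ : ℂ}
    (hμ : μ ∈ spectrum ℂ ((S.linearization.loopMatrix Δ).map Complex.ofReal)) (hre : 0 < μ.re) :
    IsUnstableEquilibrium (S.loopField Δ) 0 := by
  have h0 : S.loopField Δ 0 = 0 := by
    simp [ExposedSystem.loopField, h.loopInput_zero hS, hS.f_zero, hS.g_zero]
  -- The state space here is a product, while the loop matrix acts on functions on `Fin n ⊕ Fin k`;
  -- the coordinate change between them is linear.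
  exact ⟨h0, not_lyapunovStable_of_mem_spectrum (h.loopWellPosed hS).contDiffAt_field h0
    (LinearEquiv.sumArrowLequivProdArrow (Fin n) (Fin k) ℝ ℝ).symm.toContinuousLinearEquiv
    (h.fderiv_loopField_zero hS) hμ hre⟩

end NonlinearLoop

theorem exists_pos_forall_of_eventually_nhdsGT {P : ℝ → Prop} (h : ∀ᶠ ε in 𝓝[>] (0 : ℝ), P ε) :
    ∃ ε₀ : ℝ, 0 < ε₀ ∧ ∀ ε : ℝ, 0 < ε → ε < ε₀ → P ε := by
  obtain ⟨ε₀, hε₀, hsub⟩ := mem_nhdsGT_iff_exists_Ioo_subset.1 h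
  exact ⟨ε₀, hε₀, fun ε h1 h2 => hsub ⟨h1, h2⟩⟩

end FeedbackAttack

end

theorem corollary1 {n m p k : ℕ}
    (G : FeedbackAttack.LTI n m p) (Δ : FeedbackAttack.LTI k p m)
    (hG : G.IsStable)
    (hΔ : FeedbackAttack.IsMinimalDestabilizingAttack G Δ)
    (hwp : G.LoopWellPosed Δ) :
    (∃ ε₀ : ℝ, 0 < ε₀ ∧ ∀ ε : ℝ, 0 < ε → ε < ε₀ →
      G.LoopWellPosed (Δ.scale (1 + ε)) ∧ G.LoopInternallyUnstable (Δ.scale (1 + ε))) ∧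
    ∀ S : FeedbackAttack.ExposedSystem n m p, S.IsRegular → S.linearization = G →
      S.RobustlyWellConnected Δ →
      ∃ ε₀ : ℝ, 0 < ε₀ ∧ ∀ ε : ℝ, 0 < ε → ε < ε₀ →
        S.LoopWellPosed (Δ.scale (1 + ε)) ∧
          FeedbackAttack.IsUnstableEquilibrium (S.loopField (Δ.scale (1 + ε))) 0 := by
  -- The same eigenvalue serves both claims: directly for the linear loop, through the linearization
  -- for the nonlinear one.
  have hunst := hΔ.eventually_exists_unstable_eigenvalue hG hwp
  refine ⟨FeedbackAttack.exists_pos_forall_of_eventually_nhdsGT ?_, ?_⟩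
  · filter_upwards [hunst] with ε ⟨hε, μ, hμ, hre⟩
    exact ⟨hε, FeedbackAttack.loopInternallyUnstable_of_mem_spectrum hμ hre⟩
  · rintro S hS rfl hrob
    refine FeedbackAttack.exists_pos_forall_of_eventually_nhdsGT ?_
    filter_upwards [hunst, hrob.eventually_scale] with ε ⟨_, μ, hμ, hre⟩ hε
    exact ⟨hε.loopWellPosed hS, hε.isUnstableEquilibrium hS hμ hre⟩
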